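/- Let $V$ and $U$ be disjoint vertex sets with $|V|=n$ and $|U|=m$. Let $\boldsymbol{s}=(s_v)_{v\in V}$, $\boldsymbol{x}=(x_v)_{v\in V}$, $\boldsymbol{t}=(t_u)_{u\in U}$, $\boldsymbol{y}=(y_u)_{u\in U}$ be vectors of nonnegative integers with $$M_{st}:=\sum_{v\in V}s_v=\sum_{u\in U}t_u>10,\qquad M_{xy}:=\sum_{v\in V}x_v=\sum_{u\in U}y_u>10 .$$ Let $\operatorname{BP}(\boldsymbol{s},\boldsymbol{t},\boldsymbol{x},\boldsymbol{y})$ be the number of ordered pairs of edge-disjoint simple bipartite graphs with vertex classes $V,U$, the first with degrees $s_v$ ($v\in V$) and $t_u$ ($u\in U$), the second with degrees $x_v$ ($v\in V$) and $y_u$ ($u\in U$). Let $s_{\max},t_{\max},x_{\max},y_{\max}$ be the largest entries of the four vectors. Write $(a)_2=a(a-1)$ and put $S_2=\sum_v(s_v)_2$, $T_2=\sum_u(t_u)_2$, $X_2=\sum_v(x_v)_2$, $Y_2=\sum_u(y_u)_2$. For a vector $\boldsymbol{a}=(a_1,\dots,a_k)$ with average $\bar a=\frac1k\sum_i a_i$,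 let $c(\boldsymbol{a})=\sum_i|a_i-\bar a|$. Define $$\widehat F(\boldsymbol{s},\boldsymbol{t},\boldsymbol{x},\boldsymbol{y})=\frac{M_{st}!\,M_{xy}!}{\prod_{v\in V}s_v!\,x_v!\ \prod_{u\in U}t_u!\,y_u!}\exp\left(-\frac{S_2T_2}{2M_{st}^2}-\frac{X_2Y_2}{2M_{xy}^2}-\frac{\sum_{v\in V}s_vx_v\ \sum_{u\in U}t_uy_u}{M_{st}M_{xy}}\right),$$ $$\xi=\frac{(s_{\max}+t_{\max})^4}{M_{st}}+\frac{(s_{\max}+t_{\max})^2(x_{\max}+y_{\max})^2}{M_{st}}+\frac{(x_{\max}+y_{\max})^4}{M_{xy}},$$ $$\xi_s=\frac{c(\boldsymbol{s})\,t_{\max}\,x_{\max}}{M_{st}},\qquad \xi_t=\frac{c(\boldsymbol{t})\,s_{\max}\,y_{\max}}{M_{st}} .$$ **Theorem 3.1.** If $\xi=o(1)$, then $$\operatorname{BP}(\boldsymbol{s},\boldsymbol{t},\boldsymbol{x},\boldsymbol{y})=\widehat F(\boldsymbol{s},\boldsymbol{t},\boldsymbol{x},\boldsymbol{y})\,\exp\big(O(\xi+\min\{\xi_s,\xi_t\})\big).$$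 Here the asymptotic notation means the following: there are absolute constants $\varepsilon>0$ and $C>0$ such that, for all $n,m$ and all $\boldsymbol{s},\boldsymbol{t},\boldsymbol{x},\boldsymbol{y}$ as above with $\xi<\varepsilon$, there is a real number $\theta$ with $|\theta|\le C\,(\xi+\min\{\xi_s,\xi_t\})$ and $\operatorname{BP}(\boldsymbol{s},\boldsymbol{t},\boldsymbol{x},\boldsymbol{y})=\widehat F(\boldsymbol{s},\boldsymbol{t},\boldsymbol{x},\boldsymbol{y})\,e^{\theta}$. -/

import Mathlib

/-!
Bipartite pairs with prescribed degree sequences.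

The two vertex classes are `Fin n` (the class `V`) and `Fin m` (the class `U`), and a bipartite graph
over them is its set of edges, a finite set of pairs `(v, u)`.
-/

namespace BipPairs

/-- A (simple, labelled) bipartite graph with vertex classes `Fin n` and `Fin m`, as its edge set. -/
abbrev BipGraph (n m : ℕ) := Finset (Fin n × Fin m)

/-- The degree of the vertex `v` of the first class. -/
def degLeft {n m : ℕ} (G : BipGraph n m) (v : Fin n) : ℕ :=
  (G.filter (fun e => e.1 = v)).card

/-- The degree of the vertex `u` of the second class. -/
def degRight {n m : ℕ} (G : BipGraph n m) (u : Fin m) : ℕ :=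
  (G.filter (fun e => e.2 = u)).card

/-- `G` has bipartite degree sequence `(s, t)`. -/
def HasDegrees {n m : ℕ} (G : BipGraph n m) (s : Fin n → ℕ) (t : Fin m → ℕ) : Prop :=
  (∀ v, degLeft G v = s v) ∧ (∀ u, degRight G u = t u)

instance {n m : ℕ} (G : BipGraph n m) (s : Fin n → ℕ) (t : Fin m → ℕ) :
    Decidable (HasDegrees G s t) :=
  inferInstanceAs (Decidable (_ ∧ _))

/-- `BP s t x y`: the number of ordered pairs of edge-disjoint bipartite graphs on the same vertex
classes, the first with degree sequence `(s, t)`, the second with degree sequence `(x, y)`. -/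
def BP {n m : ℕ} (s : Fin n → ℕ) (t : Fin m → ℕ) (x : Fin n → ℕ) (y : Fin m → ℕ) : ℕ :=
  (Finset.univ.filter (fun p : BipGraph n m × BipGraph n m =>
    HasDegrees p.1 s t ∧ HasDegrees p.2 x y ∧ Disjoint p.1 p.2)).card

/-- The sum of the entries of a vector. -/
def total {k : ℕ} (a : Fin k → ℕ) : ℕ := ∑ i, a i

/-- The sum of the falling factorials `(a_i)_2 = a_i (a_i - 1)`. -/
def fallTwo {k : ℕ} (a : Fin k → ℕ) : ℕ := ∑ i, (a i).descFactorial 2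

/-- The largest entry of a vector (`0` for the empty vector). -/
def maxEntry {k : ℕ} (a : Fin k → ℕ) : ℕ := Finset.univ.sup a

/-- The average of the entries of a vector. -/
noncomputable def average {k : ℕ} (a : Fin k → ℕ) : ℝ := (∑ i, (a i : ℝ)) / (k : ℝ)

/-- The irregularity of a vector: the sum of the distances of its entries from their average. -/
noncomputable def irregularity {k : ℕ} (a : Fin k → ℕ) : ℝ := ∑ i, |(a i : ℝ) - average a|

/-- The standing conditions on the degree sequences: `M_st` and `M_xy` are well defined (both sides
of each bipartite graph have the same degree sum) and exceed `10`. -/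
structure Admissible {n m : ℕ} (s : Fin n → ℕ) (t : Fin m → ℕ) (x : Fin n → ℕ) (y : Fin m → ℕ) :
    Prop where
  sum_st : total s = total t
  sum_xy : total x = total y
  ten_lt_st : 10 < total s
  ten_lt_xy : 10 < total x

/-- The estimate for the number of bipartite pairs; `M_st = total s` and `M_xy = total x`. -/
noncomputable def FHat {n m : ℕ} (s : Fin n → ℕ) (t : Fin m → ℕ) (x : Fin n → ℕ) (y : Fin m → ℕ) :
    ℝ :=
  (((total s).factorial : ℝ) * ((total x).factorial : ℝ)) /
      ((∏ v, ((s v).factorial : ℝ) * ((x v).factorial : ℝ)) *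
        (∏ u, ((t u).factorial : ℝ) * ((y u).factorial : ℝ))) *
    Real.exp
      (-((fallTwo s : ℝ) * (fallTwo t : ℝ)) / (2 * (total s : ℝ) ^ 2)
        - ((fallTwo x : ℝ) * (fallTwo y : ℝ)) / (2 * (total x : ℝ) ^ 2)
        - ((∑ v, (s v : ℝ) * (x v : ℝ)) * (∑ u, (t u : ℝ) * (y u : ℝ))) /
            ((total s : ℝ) * (total x : ℝ)))

/-- The parameter `ξ`. -/
noncomputable def xi {n m : ℕ} (s : Fin n → ℕ) (t : Fin m → ℕ) (x : Fin n → ℕ) (y : Fin m → ℕ) :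
    ℝ :=
  ((maxEntry s : ℝ) + (maxEntry t : ℝ)) ^ 4 / (total s : ℝ)
    + ((maxEntry s : ℝ) + (maxEntry t : ℝ)) ^ 2 * ((maxEntry x : ℝ) + (maxEntry y : ℝ)) ^ 2
        / (total s : ℝ)
    + ((maxEntry x : ℝ) + (maxEntry y : ℝ)) ^ 4 / (total x : ℝ)

/-- The parameter `ξ_s`. -/
noncomputable def xiS {n m : ℕ} (s : Fin n → ℕ) (t : Fin m → ℕ) (x : Fin n → ℕ) : ℝ :=
  irregularity s * (maxEntry t : ℝ) * (maxEntry x : ℝ) / (total s : ℝ)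

/-- The parameter `ξ_t`. The denominator is `M_st`, here written as the sum of `s`. -/
noncomputable def xiT {n m : ℕ} (s : Fin n → ℕ) (t : Fin m → ℕ) (y : Fin m → ℕ) : ℝ :=
  irregularity t * (maxEntry s : ℝ) * (maxEntry y : ℝ) / (total s : ℝ)

end BipPairs

/-! Fix the second graph `H` and count the first graphs disjoint from it in the pairing model. Split
`M` points into cells of sizes `s` on one side and `t` on the other. A permutation of the points
projects to a bipartite multigraph, and every simple graph with degrees `(s, t)` comes from exactly
`∏ s_v! ∏ t_u!` permutations (`card_simple_eq`). It remains to estimate how many permutations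
project to a simple graph avoiding `H`.

The bad events are that a point pair lies over an edge of `H`, with approximate probability `1/M`,
or that two point pairs lie over the same pair of cells, with approximate probability `1/M²`. The
events are excluded one at a time. Given that those in `F` are avoided, a further event still has
its unconditional probability up to a factor `1 + O(κ/M)`, where `κ = h + Δ²`
(`card_pinned_event_bounds`). This follows from switchings, which exchange two values of the
permutation: switching a pair out gives the upper bound and switching it in gives the lower bound.
Multiplying the factors `1 - (1 + O(κ/M)) w` yields `M! exp(-W + O(κ²/M))`, with `W` the total
weight (`card_pinned_bounds`). Up to a small error `W` is `S₂T₂/(2M²)` plus `(∑_{vu ∈ H} s_v t_u)/M`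
(`sum_weight_badEvents`).

Only the last sum depends on `H` beyond its degrees. Subtracting the average of `s`, or of `t`,
shows that for every `H` with degrees `(x, y)` it is within `2 min(ξ_s, ξ_t)` of the product formula
(`HasDegrees.abs_edge_sum_sub_le`). So the estimate is uniform in `H`, and summing over `H`
multiplies it by the number of second graphs, which is the same count with nothing forbidden
(`BP_bounds`). -/

namespace BipPairs

open Finset Equiv

/-! ### Switching a prescribed pair out of a permutation: upper bounds -/

section Switching

variable {α V U : Type*} [Fintype α] [DecidableEq α]

open Classical in
/-- The permutations whose graph contains `R` and is independent for the conflict relation `E`. -/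
noncomputable def pinned (E : α × α → α × α → Prop) (R : Finset (α × α)) : Finset (Perm α) :=
  univ.filter fun σ => (∀ x ∈ R, σ x.1 = x.2) ∧
    ∀ x y, E x y → σ x.1 = x.2 → σ y.1 ≠ y.2

theorem mem_pinned {E : α × α → α × α → Prop} {R : Finset (α × α)} {σ : Perm α} :
    σ ∈ pinned E R ↔ (∀ x ∈ R, σ x.1 = x.2) ∧ ∀ x y, E x y → σ x.1 = x.2 → σ y.1 ≠ y.2 := by
  classical
  simp [pinned]

/-- A symmetric relation between pairs of points that only relates an occupied forbidden pair to
itself, or two pairs lying over the same pair of cells. -/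
structure IsConflict (a : α → V) (b : α → U) (J : α × α → Prop)
    (E : α × α → α × α → Prop) : Prop where
  symm : ∀ x y, E x y → E y x
  cases : ∀ x y, E x y → (x = y ∧ J x) ∨ (x.1 ≠ y.1 ∧ a x.1 = a y.1 ∧ b x.2 = b y.2)

open Classical in
/-- Bounds for the sizes of the cells and the number of forbidden pairs at each point. -/
structure LocalBounds (a : α → V) (b : α → U) (J : α × α → Prop) (Δ h : ℕ) : Prop where
  left : ∀ p, #{p' | a p' = a p} ≤ Δ
  right : ∀ q, #{q' | b q' = b q} ≤ Δ
  row : ∀ p, #{q | J (p, q)} ≤ h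
  col : ∀ q, #{p | J (p, q)} ≤ h

variable {a : α → V} {b : α → U} {J : α × α → Prop} {Δ h : ℕ} {E : α × α → α × α → Prop}

/-- The switching stays in the class, unless a new pair is involved in a conflict. -/
theorem switch_mem_pinned (hE : IsConflict a b J E) {R : Finset (α × α)} {σ : Perm α} {p p' : α}
    (hσ : σ ∈ pinned E R) {R' : Finset (α × α)}
    (hR : ∀ x ∈ R', (σ * swap p p') x.1 = x.2)
    (h1 : ∀ y, E (p, σ p') y → (σ * swap p p') y.1 ≠ y.2)
    (h2 : ∀ y, E (p', σ p) y → (σ * swap p p') y.1 ≠ y.2) :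
    σ * swap p p' ∈ pinned E R' := by
  rw [mem_pinned] at hσ ⊢
  refine ⟨hR, ?_⟩
  have key : ∀ x : α × α, (σ * swap p p') x.1 = x.2 →
      x = (p, σ p') ∨ x = (p', σ p) ∨ σ x.1 = x.2 := by
    rintro ⟨x1, x2⟩ hx
    by_cases e1 : x1 = p
    · subst e1; left; simpa using hx.symm
    by_cases e2 : x1 = p'
    · subst e2; right; left; simpa using hx.symm
    right; right
    simpa [swap_apply_of_ne_of_ne e1 e2] using hx
  intro x y hxy hx hy
  rcases key x hx with rfl | rfl | hx'
  · exact h1 y hxy hy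
  · exact h2 y hxy hy
  rcases key y hy with rfl | rfl | hy'
  · exact h1 x (hE.symm _ _ hxy) hx
  · exact h2 x (hE.symm _ _ hxy) hx
  exact hσ.2 x y hxy hx' hy'

-- With `z = (p, q)`, the switching with `p'` can fail only if `p'` is a first point of `R` (at most
-- `3`), if `(p, σ p')` or `(p', q)` is forbidden (at most `h` each), or if one of these new pairs
-- shares its cells with another pair. Each of the last two cases leaves at most `Δ²` choices of
-- `p'`.
open Classical in
theorem card_bad_switch_le (hE : IsConflict a b J E) (hb : LocalBounds a b J Δ h)
    {R : Finset (α × α)} (hR : #R ≤ 3) {z : α × α} (hz : z ∉ R) {σ : Perm α}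
    (hσ : σ ∈ pinned E (insert z R)) :
    #{p' | σ * swap z.1 p' ∉ pinned E R} ≤ 3 + 2 * h + 2 * Δ ^ 2 := by
  obtain ⟨p, q⟩ := z
  have hm := mem_pinned.1 hσ
  have hpq : σ p = q := hm.1 (p, q) (mem_insert_self _ _)
  have hσR : σ ∈ pinned E R :=
    mem_pinned.2 ⟨fun x hx => hm.1 x (mem_insert_of_mem hx), hm.2⟩
  have hsub : ({p' | σ * swap p p' ∉ pinned E R} : Finset α) ⊆
      (R.image Prod.fst) ∪ (({q' | J (p, q')} : Finset α).image σ.symm) ∪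
        ({p' | J (p', q)} : Finset α) ∪
        (({p₂ | a p₂ = a p} : Finset α).biUnion
          fun p₂ => ({q' | b q' = b (σ p₂)} : Finset α).image σ.symm) ∪
        (({q₂ | b q₂ = b q} : Finset α).biUnion
          fun q₂ => ({p' | a p' = a (σ.symm q₂)} : Finset α)) := by
    intro p' hp'
    by_contra hcon
    simp only [mem_union, mem_image, mem_biUnion, mem_filter, mem_univ, true_and, not_or,
      not_exists, not_and] at hcon hp'
    obtain ⟨⟨⟨⟨c1, c2⟩, c3⟩, c4⟩, c5⟩ := hcon
    apply hp'
    have c2' : ¬ J (p, σ p') := fun hJ => c2 _ hJ (by simp)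
    have c4' : ∀ p₂, a p₂ = a p → b (σ p') ≠ b (σ p₂) := fun p₂ e1 e2 =>
      c4 p₂ e1 _ e2 (by simp)
    have c5' : ∀ p₂, b (σ p₂) = b q → a p' ≠ a p₂ := fun p₂ e1 e2 =>
      c5 (σ p₂) e1 (by simpa using e2)
    refine switch_mem_pinned hE hσR ?_ ?_ ?_
    · intro x hx
      have n1 : x.1 ≠ p := by
        intro e
        apply hz
        have := hm.1 x (mem_insert_of_mem hx)
        rw [e, hpq] at this
        have : x = (p, q) := Prod.ext e this.symm
        rwa [← this]
      have n2 : x.1 ≠ p' := fun e => c1 x hx e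
      simpa [swap_apply_of_ne_of_ne n1 n2] using hm.1 x (mem_insert_of_mem hx)
    · rintro ⟨p₂, q₂⟩ hy hy'
      rcases hE.cases _ _ hy with ⟨-, hJ⟩ | ⟨e1, e2, e3⟩
      · exact c2' hJ
      · by_cases e : p₂ = p'
        · subst e
          simp only [Perm.coe_mul, Function.comp_apply, swap_apply_right] at hy'
          exact c4' p rfl (by rw [hy']; exact e3)
        · simp only [Perm.coe_mul, Function.comp_apply,
            swap_apply_of_ne_of_ne (Ne.symm e1) e] at hy'
          exact c4' p₂ e2.symm (by rw [hy']; exact e3)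
    · rintro ⟨p₂, q₂⟩ hy hy'
      rcases hE.cases _ _ hy with ⟨-, hJ⟩ | ⟨e1, e2, e3⟩
      · exact c3 (by rwa [hpq] at hJ)
      · by_cases e : p₂ = p
        · subst e
          exact c5' p₂ (by rw [hpq]) e2
        · simp only [Perm.coe_mul, Function.comp_apply,
            swap_apply_of_ne_of_ne e (Ne.symm e1)] at hy'
          exact c5' p₂ (by rw [hy', ← hpq]; exact e3.symm) e2
  refine (card_le_card hsub).trans ?_
  have k1 : #(R.image Prod.fst) ≤ 3 := card_image_le.trans hR
  have k2 : #(({q' | J (p, q')} : Finset α).image σ.symm) ≤ h := card_image_le.trans (hb.row p)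
  have k3 := hb.col q
  have k4 : #(({p₂ | a p₂ = a p} : Finset α).biUnion
          fun p₂ => ({q' | b q' = b (σ p₂)} : Finset α).image σ.symm) ≤ Δ * Δ :=
    (card_biUnion_le_card_mul _ _ _ fun p₂ _ => card_image_le.trans (hb.right _)).trans
      (Nat.mul_le_mul_right _ (hb.left p))
  have k5 : #(({q₂ | b q₂ = b q} : Finset α).biUnion
          fun q₂ => ({p' | a p' = a (σ.symm q₂)} : Finset α)) ≤ Δ * Δ :=
    (card_biUnion_le_card_mul _ _ _ fun q₂ _ => hb.left _).trans
      (Nat.mul_le_mul_right _ (hb.right q))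
  have u1 := card_union_le (R.image Prod.fst) (({q' | J (p, q')} : Finset α).image σ.symm)
  have u2 := card_union_le ((R.image Prod.fst) ∪ (({q' | J (p, q')} : Finset α).image σ.symm))
    ({p' | J (p', q)} : Finset α)
  have u3 := card_union_le ((R.image Prod.fst) ∪ (({q' | J (p, q')} : Finset α).image σ.symm) ∪
    ({p' | J (p', q)} : Finset α)) (({p₂ | a p₂ = a p} : Finset α).biUnion
          fun p₂ => ({q' | b q' = b (σ p₂)} : Finset α).image σ.symm)
  refine (card_union_le _ _).trans ?_
  have : Δ ^ 2 = Δ * Δ := sq Δ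
  omega

/-- Switching a prescribed pair away. -/
theorem card_pinned_insert_mul_le (hE : IsConflict a b J E) (hb : LocalBounds a b J Δ h)
    {R : Finset (α × α)} (hR : #R ≤ 3) {z : α × α} (hz : z ∉ R) :
    #(pinned E (insert z R)) * (Fintype.card α - (3 + 2 * h + 2 * Δ ^ 2)) ≤ #(pinned E R) := by
  classical
  have h1 : #(pinned E (insert z R)) * (Fintype.card α - (3 + 2 * h + 2 * Δ ^ 2)) ≤
      ∑ σ ∈ pinned E (insert z R), #{p' | σ * swap z.1 p' ∈ pinned E R} := by
    rw [← smul_eq_mul]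
    refine card_nsmul_le_sum _ _ _ fun σ hσ => ?_
    have := card_bad_switch_le hE hb hR hz hσ
    have h2 := card_filter_add_card_filter_not (s := (univ : Finset α))
      (fun p' => σ * swap z.1 p' ∈ pinned E R)
    rw [card_univ] at h2
    omega
  refine h1.trans ?_
  rw [← card_sigma]
  refine card_le_card_of_injOn (fun x => x.1 * swap z.1 x.2) ?_ ?_
  · rintro ⟨σ, p'⟩ hx
    simp only [coe_sigma, Set.mem_sigma_iff, mem_coe, mem_filter, mem_univ, true_and] at hx
    exact hx.2
  · rintro ⟨σ, p₁⟩ hx ⟨τ, p₂⟩ hy hxy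
    simp only [coe_sigma, Set.mem_sigma_iff, mem_coe, mem_filter, mem_univ, true_and] at hx hy hxy
    have e1 : σ z.1 = z.2 := (mem_pinned.1 hx.1).1 z (mem_insert_self _ _)
    have e2 : τ z.1 = z.2 := (mem_pinned.1 hy.1).1 z (mem_insert_self _ _)
    -- The switched permutation sends `p'` to `z.2`, so it determines `p'` and then `σ`.
    have e3 : p₁ = p₂ := by
      apply (σ * swap z.1 p₁).injective
      conv_rhs => rw [hxy]
      simp [e1, e2]
    subst e3
    have := mul_right_cancel hxy
    subst this
    rfl

/-- Each pin costs a factor of at most `2 / M`. This crude form serves for the error terms of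
`card_bad_insert_le`, where up to three pins are added to a set of at most one; hence `#R ≤ 3`. -/
theorem card_pinned_insert_le (hE : IsConflict a b J E) (hb : LocalBounds a b J Δ h)
    (hM : 2 * (3 + 2 * h + 2 * Δ ^ 2) ≤ Fintype.card α)
    {R : Finset (α × α)} (hR : #R ≤ 3) {z : α × α} (hz : z ∉ R) :
    (#(pinned E (insert z R)) : ℝ) ≤ #(pinned E R) * (2 / Fintype.card α) := by
  have h1 := card_pinned_insert_mul_le hE hb hR hz
  have h2 : (Fintype.card α : ℝ) ≤ 2 * ((Fintype.card α - (3 + 2 * h + 2 * Δ ^ 2) : ℕ) : ℝ) := by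
    have : Fintype.card α ≤ 2 * (Fintype.card α - (3 + 2 * h + 2 * Δ ^ 2)) := by omega
    exact_mod_cast this
  have h3 : (0 : ℝ) < Fintype.card α := by
    have : 0 < Fintype.card α := by omega
    exact_mod_cast this
  rw [← mul_div_assoc, le_div_iff₀ h3]
  have h4 : (#(pinned E (insert z R)) : ℝ) * ((Fintype.card α - (3 + 2 * h + 2 * Δ ^ 2) : ℕ) : ℝ)
      ≤ #(pinned E R) := by exact_mod_cast h1
  nlinarith [Nat.cast_nonneg (α := ℝ) #(pinned E (insert z R))]

end Switching

/-! ### Switching a prescribed pair into a permutation: lower bounds -/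

section Switching

variable {α V U : Type*} [Fintype α]
variable {a : α → V} {b : α → U} {J : α × α → Prop} {Δ h : ℕ} {E : α × α → α × α → Prop}

open Classical in
/-- The pairs of points over the same pair of cells as `x`. -/
noncomputable def sameCells (a : α → V) (b : α → U) (x : α × α) : Finset (α × α) :=
  ({p | a p = a x.1} : Finset α) ×ˢ ({q | b q = b x.2} : Finset α)

theorem mem_sameCells {x y : α × α} :
    y ∈ sameCells a b x ↔ a y.1 = a x.1 ∧ b y.2 = b x.2 := by
  classical
  simp [sameCells]

theorem LocalBounds.card_sameCells_le (hb : LocalBounds a b J Δ h) (x : α × α) :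
    #(sameCells a b x) ≤ Δ ^ 2 := by
  classical
  rw [sameCells, card_product, sq]
  exact Nat.mul_le_mul (hb.left _) (hb.right _)

variable [DecidableEq α]

open Classical in
theorem LocalBounds.card_forbidden_le (hb : LocalBounds a b J Δ h) :
    #{x | J x} ≤ Fintype.card α * h := by
  have : ({x | J x} : Finset (α × α)) ⊆
      (univ : Finset α).biUnion fun p => ({q | J (p, q)} : Finset α).image fun q => (p, q) := by
    rintro ⟨p, q⟩ hx
    simpa using hx
  refine (card_le_card this).trans ?_
  rw [← card_univ]
  exact card_biUnion_le_card_mul _ _ _ fun p _ => card_image_le.trans (hb.row p)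

theorem card_biUnion_le_mul_real {ι β : Type*} [DecidableEq β] (s : Finset ι) (t : ι → Finset β)
    (c : ℝ) (hc : ∀ i ∈ s, (#(t i) : ℝ) ≤ c) : (#(s.biUnion t) : ℝ) ≤ #s * c := by
  calc (#(s.biUnion t) : ℝ) ≤ ∑ i ∈ s, (#(t i) : ℝ) := by exact_mod_cast card_biUnion_le
    _ ≤ ∑ _i ∈ s, c := sum_le_sum hc
    _ = #s * c := by simp

open Classical in
/-- The permutations for which switching the pair `z` in may create a conflict. -/
theorem card_bad_insert_le (hE : IsConflict a b J E) (hb : LocalBounds a b J Δ h)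
    (hM : 2 * (3 + 2 * h + 2 * Δ ^ 2) ≤ Fintype.card α)
    {R : Finset (α × α)} (hR : #R ≤ 1) {z : α × α} (hz : ∀ r ∈ R, r.1 ≠ z.1 ∧ r.2 ≠ z.2)
    (hzz : ¬ E z z) (hzR : ∀ r ∈ R, ¬ E z r) :
    (#{σ ∈ pinned E R | σ * swap z.1 (σ.symm z.2) ∉ pinned E (insert z R)} : ℝ) ≤
      #(pinned E R) * ((4 * h + 18 * Δ ^ 2) / Fintype.card α) := by
  obtain ⟨p, q⟩ := z
  set M := Fintype.card α with hMdef
  -- Switching in creates `(p, q)` and `w = (σ⁻¹ q, σ p)`. Failure means that a pair `y` over the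
  -- cells of `(p, q)` is present (`I₁`, one extra pin), or that `w` is forbidden or lies over the
  -- cells of `(p, q)` or of a member of `R` (`I₂`, where the old pairs `(w.1, q)` and `(p, w.2)`
  -- are two pins), or that some other pair `y` lies over the cells of `w` (`I₃`, three pins).
  set I₁ : Finset (α × α) := {y ∈ sameCells a b (p, q) | y ∉ R} with hI₁
  set I₂ : Finset (α × α) := {w ∈ ({x | J x} : Finset (α × α)) ∪ sameCells a b (p, q) ∪
    R.biUnion (sameCells a b) | w.1 ≠ p ∧ w.2 ≠ q} with hI₂
  set I₃ : Finset ((_ : α × α) × (α × α)) :=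
    (univ.filter fun w : α × α => w.1 ≠ p ∧ w.2 ≠ q).sigma fun w =>
      {y ∈ sameCells a b w | y.1 ≠ p ∧ y.1 ≠ w.1 ∧ y ∉ R} with hI₃
  have hsub : ({σ ∈ pinned E R | σ * swap p (σ.symm q) ∉ pinned E (insert (p, q) R)} :
      Finset (Perm α)) ⊆
      (I₁.biUnion fun y => pinned E (insert y R)) ∪
      (I₂.biUnion fun w => pinned E (insert (p, w.2) (insert (w.1, q) R))) ∪
      (I₃.biUnion fun w => pinned E (insert w.2 (insert (p, w.1.2) (insert (w.1.1, q) R)))) := by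
    intro σ hσ
    rw [mem_filter] at hσ
    obtain ⟨hσR, hbad⟩ := hσ
    have hm := mem_pinned.1 hσR
    by_contra hcon
    simp only [mem_union, mem_biUnion, not_or, not_exists, not_and] at hcon
    obtain ⟨⟨c1, c2⟩, c3⟩ := hcon
    have hpins : ∀ x, σ x.1 = x.2 → ∀ R', σ ∈ pinned E R' → σ ∈ pinned E (insert x R') := by
      intro x hx R' hR'
      refine mem_pinned.2 ⟨fun y hy => ?_, hm.2⟩
      rcases mem_insert.1 hy with rfl | hy
      · exact hx
      · exact (mem_pinned.1 hR').1 y hy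
    -- If `p' = p`, the pair is already present and the switching is trivial, so failure forces `p'
    -- ≠ p`.
    set p' := σ.symm q with hp'
    have hσp' : σ p' = q := by simp [hp']
    have hne : p' ≠ p := by
      intro e
      apply hbad
      rw [e, swap_self, ← Perm.one_def, mul_one]
      exact hpins (p, q) (by rw [← e]; exact hσp') _ hσR
    have hne' : σ p ≠ q := by
      intro e; apply hne; rw [hp', ← e]; simp
    have d2 : (p', σ p) ∉ I₂ := fun hw =>
      c2 _ hw (hpins (p, σ p) rfl _ (hpins (p', q) hσp' _ hσR))
    apply hbad
    refine switch_mem_pinned hE hσR ?_ ?_ ?_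
    · intro x hx
      rcases mem_insert.1 hx with rfl | hx
      · simpa using hσp'
      · have n1 := (hz x hx).1
        have n2 : x.1 ≠ p' := by
          intro e
          apply (hz x hx).2
          rw [← hm.1 x hx, e]
          exact hσp'
        simpa [swap_apply_of_ne_of_ne n1 n2] using hm.1 x hx
    · rintro ⟨p₂, q₂⟩ hy hy'
      rw [hσp'] at hy
      rcases hE.cases _ _ hy with ⟨e, -⟩ | ⟨e1, e2, e3⟩
      · rw [← e] at hy; exact hzz hy
      · by_cases e : p₂ = p'
        · subst e
          simp only [Perm.coe_mul, Function.comp_apply, swap_apply_right] at hy'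
          apply d2
          rw [hI₂, mem_filter]
          refine ⟨mem_union_left _ (mem_union_right _ (mem_sameCells.2 ⟨e2.symm, ?_⟩)), hne, hne'⟩
          rw [hy']; exact e3.symm
        · simp only [Perm.coe_mul, Function.comp_apply,
            swap_apply_of_ne_of_ne (Ne.symm e1) e] at hy'
          refine c1 (p₂, q₂) ?_ (hpins _ hy' _ hσR)
          rw [hI₁, mem_filter]
          exact ⟨mem_sameCells.2 ⟨e2.symm, e3.symm⟩, fun hyR => hzR _ hyR hy⟩
    · rintro ⟨p₂, q₂⟩ hy hy'
      rcases hE.cases _ _ hy with ⟨-, hJ⟩ | ⟨e1, e2, e3⟩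
      · apply d2
        rw [hI₂, mem_filter]
        exact ⟨mem_union_left _ (mem_union_left _ (by simpa using hJ)), hne, hne'⟩
      · by_cases e : p₂ = p
        · subst e
          have : q₂ = q := by rw [← hσp']; simpa using hy'.symm
          subst this
          apply d2
          rw [hI₂, mem_filter]
          exact ⟨mem_union_left _ (mem_union_right _ (mem_sameCells.2 ⟨e2, e3⟩)), hne, hne'⟩
        · simp only [Perm.coe_mul, Function.comp_apply,
            swap_apply_of_ne_of_ne e (Ne.symm e1)] at hy'
          by_cases hyR : (p₂, q₂) ∈ R
          · apply d2
            rw [hI₂, mem_filter]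
            exact ⟨mem_union_right _ (mem_biUnion.2 ⟨_, hyR, mem_sameCells.2 ⟨e2, e3⟩⟩), hne, hne'⟩
          · refine c3 ⟨(p', σ p), (p₂, q₂)⟩ ?_
              (hpins _ hy' _ (hpins (p, σ p) rfl _ (hpins (p', q) hσp' _ hσR)))
            rw [hI₃, mem_sigma, mem_filter, mem_filter]
            exact ⟨⟨mem_univ _, hne, hne'⟩, mem_sameCells.2 ⟨e2.symm, e3.symm⟩, e, Ne.symm e1, hyR⟩
  have hM0 : (0 : ℝ) < M := by
    have : 0 < M := by omega
    exact_mod_cast this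
  set P : ℝ := (#(pinned E R) : ℝ) with hP
  have hP0 : 0 ≤ P := by positivity
  set c : ℝ := 2 / M with hc
  have hc0 : 0 ≤ c := by positivity
  have one : ∀ y ∉ R, (#(pinned E (insert y R)) : ℝ) ≤ P * c := fun y hy =>
    card_pinned_insert_le hE hb hM (by omega) hy
  have two : ∀ w : α × α, w.1 ≠ p → w.2 ≠ q →
      (#(pinned E (insert (p, w.2) (insert (w.1, q) R))) : ℝ) ≤ P * c * c := by
    intro w h1 h2
    refine (card_pinned_insert_le hE hb hM ?_ ?_).trans
      (mul_le_mul_of_nonneg_right (one _ ?_) hc0)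
    · exact (card_insert_le _ _).trans (by omega)
    · rw [mem_insert, not_or]
      exact ⟨fun e => h1 (congrArg Prod.fst e).symm, fun e => (hz _ e).1 rfl⟩
    · exact fun e => (hz _ e).2 rfl
  have three : ∀ w y : α × α, w.1 ≠ p → w.2 ≠ q → y.1 ≠ p → y.1 ≠ w.1 → y ∉ R →
      (#(pinned E (insert y (insert (p, w.2) (insert (w.1, q) R)))) : ℝ) ≤ P * c * c * c := by
    intro w y h1 h2 h3 h4 h5
    refine (card_pinned_insert_le hE hb hM ?_ ?_).trans
      (mul_le_mul_of_nonneg_right (two w h1 h2) hc0)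
    · have := card_insert_le (p, w.2) (insert (w.1, q) R)
      have := card_insert_le (w.1, q) R
      omega
    · rw [mem_insert, mem_insert, not_or, not_or]
      exact ⟨fun e => h3 (congrArg Prod.fst e), fun e => h4 (by rw [e]), h5⟩
  have n1 : (#I₁ : ℝ) ≤ (Δ : ℝ) ^ 2 := by
    exact_mod_cast (card_filter_le _ _).trans (hb.card_sameCells_le _)
  have n2 : (#I₂ : ℝ) ≤ M * h + 2 * (Δ : ℝ) ^ 2 := by
    have e1 := card_union_le (({x | J x} : Finset (α × α)) ∪ sameCells a b (p, q))
      (R.biUnion (sameCells a b))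
    have e2 := card_union_le ({x | J x} : Finset (α × α)) (sameCells a b (p, q))
    have e3 := hb.card_forbidden_le
    have e4 := hb.card_sameCells_le (p, q)
    have e5 : #(R.biUnion (sameCells a b)) ≤ 1 * Δ ^ 2 :=
      (card_biUnion_le_card_mul _ _ _ fun r _ => hb.card_sameCells_le r).trans
        (Nat.mul_le_mul_right _ hR)
    have e6 : #I₂ ≤ _ := card_filter_le _ _
    have : #I₂ ≤ M * h + 2 * Δ ^ 2 := by rw [← hMdef] at e3; omega
    exact_mod_cast this
  have n3 : (#I₃ : ℝ) ≤ (M : ℝ) ^ 2 * (Δ : ℝ) ^ 2 := by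
    have : #I₃ ≤ M ^ 2 * Δ ^ 2 := by
      rw [hI₃, card_sigma]
      refine (sum_le_card_nsmul _ _ (Δ ^ 2) fun w _ =>
        (card_filter_le _ _).trans (hb.card_sameCells_le w)).trans ?_
      rw [smul_eq_mul]
      refine Nat.mul_le_mul_right _ ((card_filter_le _ _).trans ?_)
      rw [card_univ, Fintype.card_prod, sq]
    exact_mod_cast this
  have m1 := card_biUnion_le_mul_real I₁ (fun y => pinned E (insert y R)) (P * c)
    fun y hy => one y (mem_filter.1 hy).2
  have m2 := card_biUnion_le_mul_real I₂
    (fun w => pinned E (insert (p, w.2) (insert (w.1, q) R))) (P * c * c)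
    fun w hw => two w (mem_filter.1 hw).2.1 (mem_filter.1 hw).2.2
  have m3 := card_biUnion_le_mul_real I₃
    (fun w => pinned E (insert w.2 (insert (p, w.1.2) (insert (w.1.1, q) R)))) (P * c * c * c)
    fun w hw => by
      rw [hI₃, mem_sigma, mem_filter, mem_filter] at hw
      exact three w.1 w.2 hw.1.2.1 hw.1.2.2 hw.2.2.1 hw.2.2.2.1 hw.2.2.2.2
  have tot : (#{σ ∈ pinned E R | σ * swap p (σ.symm q) ∉ pinned E (insert (p, q) R)} : ℝ) ≤
      #I₁ * (P * c) + #I₂ * (P * c * c) + #I₃ * (P * c * c * c) := by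
    refine le_trans ?_ (add_le_add (add_le_add m1 m2) m3)
    exact_mod_cast (card_le_card hsub).trans ((card_union_le _ _).trans
      (Nat.add_le_add_right (card_union_le _ _) _))
  refine tot.trans ?_
  have hM1 : (1 : ℝ) ≤ M := by
    have : 1 ≤ M := by omega
    exact_mod_cast this
  -- With `c = 2 / M`, the three families contribute `2Δ²/M`, `4h/M + 8Δ²/M²` and `8Δ²/M` relative
  -- to `P`.
  calc #I₁ * (P * c) + #I₂ * (P * c * c) + #I₃ * (P * c * c * c)
      ≤ (Δ : ℝ) ^ 2 * (P * c) + (M * h + 2 * (Δ : ℝ) ^ 2) * (P * c * c) +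
          (M : ℝ) ^ 2 * (Δ : ℝ) ^ 2 * (P * c * c * c) := by gcongr
    _ = P * ((4 * h + 10 * (Δ : ℝ) ^ 2 + 8 * (Δ : ℝ) ^ 2 / M) / M) := by
        rw [hc]; field_simp; ring
    _ ≤ P * ((4 * h + 10 * (Δ : ℝ) ^ 2 + 8 * (Δ : ℝ) ^ 2) / M) := by
        gcongr
        exact div_le_self (by positivity) hM1
    _ = P * ((4 * h + 18 * (Δ : ℝ) ^ 2) / M) := by ring

/-- Switching a pair in. -/
theorem le_card_pinned_insert (hE : IsConflict a b J E) (hb : LocalBounds a b J Δ h)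
    (hM : 2 * (3 + 2 * h + 2 * Δ ^ 2) ≤ Fintype.card α)
    {R : Finset (α × α)} (hR : #R ≤ 1) {z : α × α} (hz : ∀ r ∈ R, r.1 ≠ z.1 ∧ r.2 ≠ z.2)
    (hzz : ¬ E z z) (hzR : ∀ r ∈ R, ¬ E z r) :
    (#(pinned E R) : ℝ) * (1 - (4 * h + 18 * Δ ^ 2) / Fintype.card α) ≤
      #(pinned E (insert z R)) * Fintype.card α := by
  classical
  have h1 := card_bad_insert_le hE hb hM hR hz hzz hzR
  have h2 := card_filter_add_card_filter_not (s := pinned E R)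
    (fun σ => σ * swap z.1 (σ.symm z.2) ∈ pinned E (insert z R))
  have h3 : #{σ ∈ pinned E R | σ * swap z.1 (σ.symm z.2) ∈ pinned E (insert z R)} ≤
      #(pinned E (insert z R)) * Fintype.card α := by
    rw [← card_univ, ← card_product]
    -- Recording the old preimage of `z.2` makes the switching injective, at the cost of a factor
    -- `M`.
    refine card_le_card_of_injOn (fun σ => (σ * swap z.1 (σ.symm z.2), σ.symm z.2)) ?_ ?_
    · intro σ hσ
      simp only [coe_filter, Set.mem_ofPred_eq] at hσ
      simpa using hσ.2
    · intro σ hσ τ hτ hστ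
      simp only [Prod.mk.injEq] at hστ
      rw [hστ.2] at hστ
      exact mul_right_cancel hστ.1
  have h2' : (#(pinned E R) : ℝ) =
      #{σ ∈ pinned E R | σ * swap z.1 (σ.symm z.2) ∈ pinned E (insert z R)} +
      #{σ ∈ pinned E R | σ * swap z.1 (σ.symm z.2) ∉ pinned E (insert z R)} := by
    exact_mod_cast h2.symm
  have h3' : (#{σ ∈ pinned E R | σ * swap z.1 (σ.symm z.2) ∈ pinned E (insert z R)} : ℝ) ≤
      #(pinned E (insert z R)) * Fintype.card α := by exact_mod_cast h3
  linarith

end Switching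

/-! ### Excluding the bad events one at a time -/

section Events

variable {α V U : Type*} [Fintype α] [LinearOrder α]
variable {a : α → V} {b : α → U} {J : α × α → Prop} {Δ h : ℕ}

/-- The conflict relation of a set of events, an event being the occurrence of two pairs. -/
def conflictOf (F : Finset ((α × α) × (α × α))) (x y : α × α) : Prop :=
  (x, y) ∈ F ∨ (y, x) ∈ F

open Classical in
/-- All bad events: a forbidden pair, or two pairs over the same non-forbidden pair of cells. -/
noncomputable def badEvents (a : α → V) (b : α → U) (J : α × α → Prop) :
    Finset ((α × α) × (α × α)) :=
  {e | (e.1 = e.2 ∧ J e.1) ∨ (e.1.1 < e.2.1 ∧ e.1.2 ≠ e.2.2 ∧ a e.1.1 = a e.2.1 ∧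
    b e.1.2 = b e.2.2 ∧ ¬ J e.1 ∧ ¬ J e.2)}

omit [Fintype α] [LinearOrder α] in
theorem conflictOf_symm {F : Finset ((α × α) × (α × α))} {x y : α × α} (hxy : conflictOf F x y) :
    conflictOf F y x := hxy.symm

theorem mem_badEvents {x y : α × α} : (x, y) ∈ badEvents a b J ↔
    (x = y ∧ J x) ∨ (x.1 < y.1 ∧ x.2 ≠ y.2 ∧ a x.1 = a y.1 ∧ b x.2 = b y.2 ∧ ¬ J x ∧ ¬ J y) := by
  classical
  simp [badEvents]

/-- Any subset of the bad events is allowed, since the induction passes through partial sets of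
excluded events. -/
theorem isConflict_conflictOf {F : Finset ((α × α) × (α × α))} (hF : F ⊆ badEvents a b J) :
    IsConflict a b J (conflictOf F) := by
  refine ⟨fun _ _ => conflictOf_symm, fun x y hxy => ?_⟩
  rcases hxy with hxy | hxy <;> rcases mem_badEvents.1 (hF hxy) with ⟨h1, h2⟩ | ⟨h1, -, h3, h4, -⟩
  · exact Or.inl ⟨h1, h2⟩
  · exact Or.inr ⟨h1.ne, h3, h4⟩
  · exact Or.inl ⟨h1.symm, h1 ▸ h2⟩
  · exact Or.inr ⟨h1.ne', h3.symm, h4.symm⟩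

/-- The approximate probability of an event in a uniform permutation of `M` points. -/
noncomputable def weight (M : ℕ) (e : (α × α) × (α × α)) : ℝ :=
  if e.1 = e.2 then 1 / (M : ℝ) else 1 / (M : ℝ) ^ 2

/-- A permutation avoiding `F` either avoids the new event or realises it. For a forbidden pair `x =
y`, the set `{y, x}` collapses to one pin, so both kinds of event are treated alike. -/
theorem card_pinned_conflictOf_insert (F : Finset ((α × α) × (α × α))) (x y : α × α) :
    #(pinned (conflictOf (insert (x, y) F)) ∅) + #(pinned (conflictOf F) {y, x}) =
      #(pinned (conflictOf F) ∅) := by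
  classical
  rw [← card_filter_add_card_filter_not (s := pinned (conflictOf F) ∅)
    (fun σ : Perm α => ¬ (σ x.1 = x.2 ∧ σ y.1 = y.2))]
  congr 2
  · ext σ
    simp only [mem_filter, mem_pinned, conflictOf, mem_insert, Prod.mk.injEq]
    constructor
    · rintro ⟨-, h⟩
      refine ⟨⟨by simp, fun u v huv => h u v (huv.imp Or.inr Or.inr)⟩, fun hxy => ?_⟩
      exact h x y (Or.inl (Or.inl ⟨rfl, rfl⟩)) hxy.1 hxy.2
    · rintro ⟨⟨-, h⟩, hxy⟩
      refine ⟨by simp, ?_⟩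
      rintro u v ((⟨rfl, rfl⟩ | huv) | (⟨rfl, rfl⟩ | huv)) hu hv
      · exact hxy ⟨hu, hv⟩
      · exact h u v (Or.inl huv) hu hv
      · exact hxy ⟨hv, hu⟩
      · exact h u v (Or.inr huv) hu hv
  · ext σ
    simp only [mem_filter, mem_pinned, mem_insert, mem_singleton, not_not]
    constructor
    · rintro ⟨h1, h2⟩
      exact ⟨⟨by simp, h2⟩, h1 x (Or.inr rfl), h1 y (Or.inl rfl)⟩
    · rintro ⟨⟨-, h2⟩, hx, hy⟩
      refine ⟨?_, h2⟩
      rintro u (rfl | rfl)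
      exacts [hy, hx]

/-- The conditional probability of a single pair is at most `(1 + O(κ / M)) / M`. -/
theorem card_pinned_insert_le_sharp {E : α × α → α × α → Prop} (hE : IsConflict a b J E)
    (hb : LocalBounds a b J Δ h) (hΔ : 1 ≤ Δ)
    (hM : 36 * (h + Δ ^ 2) * 2 ≤ Fintype.card α)
    {R : Finset (α × α)} (hR : #R ≤ 3) {z : α × α} (hz : z ∉ R) :
    (#(pinned E (insert z R)) : ℝ) * Fintype.card α ≤
      #(pinned E R) * (1 + 10 * (h + Δ ^ 2) / Fintype.card α) := by
  have h1 := card_pinned_insert_mul_le hE hb hR hz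
  have hΔ2 : 1 ≤ Δ ^ 2 := Nat.one_le_pow _ _ hΔ
  set M := Fintype.card α
  have hM0 : (0 : ℝ) < M := by
    have : 0 < M := by omega
    exact_mod_cast this
  have hle : 3 + 2 * h + 2 * Δ ^ 2 ≤ 5 * (h + Δ ^ 2) := by omega
  set κ := h + Δ ^ 2 with hκ
  have h2 : #(pinned E (insert z R)) * (M - 5 * κ) ≤ #(pinned E R) :=
    (Nat.mul_le_mul_left _ (by omega)).trans h1
  have h3 : (#(pinned E (insert z R)) : ℝ) * (M - 5 * κ) ≤ #(pinned E R) := by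
    have : ((M - 5 * κ : ℕ) : ℝ) = M - 5 * κ := by
      rw [Nat.cast_sub (by omega)]; push_cast; ring
    rw [← this]; exact_mod_cast h2
  have hκM : 72 * (κ : ℝ) ≤ M := by
    have : 72 * κ ≤ M := by omega
    exact_mod_cast this
  have hκe : ((h : ℝ) + (Δ : ℝ) ^ 2) = (κ : ℝ) := by rw [hκ]; push_cast; ring
  rw [hκe]
  have hκ0 : (0 : ℝ) ≤ κ := Nat.cast_nonneg _
  -- This is `1 / (1 - 5ε) ≤ 1 + 10ε` for `ε = κ / M ≤ 1/10`.
  have h4 : (M : ℝ) ≤ (M - 5 * κ) * (1 + 10 * κ / M) := by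
    have : (M - 5 * κ) * (1 + 10 * κ / M) = (M : ℝ) + 5 * κ * (M - 10 * κ) / M := by
      field_simp; ring
    rw [this]
    have : 0 ≤ 5 * κ * (M - 10 * κ) / (M : ℝ) :=
      div_nonneg (mul_nonneg (by positivity) (by linarith)) hM0.le
    linarith
  calc (#(pinned E (insert z R)) : ℝ) * M
      ≤ #(pinned E (insert z R)) * ((M - 5 * κ) * (1 + 10 * κ / M)) := by gcongr
    _ = #(pinned E (insert z R)) * (M - 5 * κ) * (1 + 10 * κ / M) := by ring
    _ ≤ _ := by gcongr

/-- Conditioned on avoiding the events in `F`, a further event has almost its unconditional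
probability. -/
theorem card_pinned_event_bounds (hb : LocalBounds a b J Δ h) (hΔ : 1 ≤ Δ)
    (hM : 36 * (h + Δ ^ 2) * 2 ≤ Fintype.card α) {F : Finset ((α × α) × (α × α))}
    (hF : F ⊆ badEvents a b J) {x y : α × α} (he : (x, y) ∈ badEvents a b J) (heF : (x, y) ∉ F) :
    (#(pinned (conflictOf F) ∅) : ℝ) * ((1 - 36 * (h + Δ ^ 2) / Fintype.card α) *
        weight (Fintype.card α) (x, y)) ≤ #(pinned (conflictOf F) {y, x}) ∧
      (#(pinned (conflictOf F) {y, x}) : ℝ) ≤ #(pinned (conflictOf F) ∅) *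
        ((1 + 36 * (h + Δ ^ 2) / Fintype.card α) * weight (Fintype.card α) (x, y)) := by
  have hE := isConflict_conflictOf hF
  have hΔ2 : 1 ≤ Δ ^ 2 := Nat.one_le_pow _ _ hΔ
  have hM' : 2 * (3 + 2 * h + 2 * Δ ^ 2) ≤ Fintype.card α := by omega
  have up0 := fun z => card_pinned_insert_le_sharp hE hb hΔ hM (R := ∅) (by simp) (z := z) (by simp)
  have lo0 := fun z (hzz : ¬ conflictOf F z z) =>
    le_card_pinned_insert hE hb hM' (R := ∅) (by simp) (z := z) (by simp) hzz (by simp)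
  set M := Fintype.card α with hMdef
  have hM0 : (0 : ℝ) < M := by
    have : 0 < M := by omega
    exact_mod_cast this
  have hκM : 72 * ((h : ℝ) + (Δ : ℝ) ^ 2) ≤ M := by
    have : 72 * (h + Δ ^ 2) ≤ M := by omega
    exact_mod_cast this
  set κ : ℝ := (h : ℝ) + (Δ : ℝ) ^ 2 with hκ
  have hκ0 : 0 ≤ κ := by positivity
  have hδ : (4 * (h : ℝ) + 18 * (Δ : ℝ) ^ 2) / M ≤ 18 * κ / M := by
    gcongr
    rw [hκ]
    have : (0 : ℝ) ≤ h := Nat.cast_nonneg _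
    linarith
  set ε : ℝ := κ / M with hε
  have hε0 : 0 ≤ ε := by positivity
  have hε1 : 72 * ε ≤ 1 := by rw [hε, ← mul_div_assoc, div_le_one hM0]; exact hκM
  have r18 : 18 * κ / M = 18 * ε := by rw [hε]; ring
  have r10 : 10 * κ / M = 10 * ε := by rw [hε]; ring
  have r36 : 36 * κ / M = 36 * ε := by rw [hε]; ring
  rw [r18] at hδ
  rw [r36]
  simp only [r10] at up0
  -- This is why `badEvents` omits double pairs over forbidden cells: a pair excluded by `F` itself
  -- could not be switched in.
  have hno : ∀ z, ¬ J z → ¬ conflictOf F z z := by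
    intro z hz hzz
    rcases hE.cases _ _ hzz with ⟨-, h2⟩ | ⟨h1, -⟩
    · exact hz h2
    · exact h1 rfl
  have hP0 : (0 : ℝ) ≤ #(pinned (conflictOf F) ∅) := Nat.cast_nonneg _
  set P : ℝ := ((#(pinned (conflictOf F) ∅) : ℕ) : ℝ)
  rcases mem_badEvents.1 he with ⟨rfl, hJ⟩ | ⟨h1, h2, h3, h4, h5, h6⟩
  · have hw : weight M (x, x) = 1 / M := by simp [weight]
    rw [hw, pair_eq_singleton, ← insert_empty_eq]
    have l := lo0 x (by rintro (h | h) <;> exact heF h)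
    have u := up0 x
    constructor
    · rw [mul_one_div, mul_div_assoc', div_le_iff₀ hM0]
      refine le_trans ?_ l
      gcongr
      linarith
    · rw [mul_one_div, mul_div_assoc', le_div_iff₀ hM0]
      refine u.trans ?_
      gcongr
      linarith
  · have hne : x ≠ y := fun e => h1.ne (by rw [e])
    have hw : weight M (x, y) = 1 / M ^ 2 := by simp [weight, hne]
    have l1 := lo0 x (hno x h5)
    have u1 := up0 x
    have u2 := card_pinned_insert_le_sharp hE hb hΔ hM (R := {x}) (by simp) (z := y)
      (by simpa using hne.symm)
    -- The second pin does not conflict with the first: `(x, y)` is not yet in `F`, and `(y, x)`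
    -- violates the order condition in `badEvents`.
    have l2 := le_card_pinned_insert hE hb hM' (R := {x}) (by simp) (z := y)
      (by simpa using ⟨h1.ne, h2⟩) (hno y h6) (by
        simp only [mem_singleton, forall_eq]
        rintro (h | h)
        · rcases mem_badEvents.1 (hF h) with ⟨e, -⟩ | ⟨e, -⟩
          · exact hne e.symm
          · exact lt_asymm e h1
        · exact heF h)
    rw [insert_empty_eq] at l1 u1
    rw [r10] at u2
    set Q : ℝ := ((#(pinned (conflictOf F) {x}) : ℕ) : ℝ)
    set T : ℝ := ((#(pinned (conflictOf F) {y, x}) : ℕ) : ℝ)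
    have hQ0 : 0 ≤ Q := Nat.cast_nonneg _
    rw [hw]
    constructor
    · rw [mul_one_div, mul_div_assoc', div_le_iff₀ (by positivity)]
      have i1 : P * (1 - 18 * ε) ≤ Q * M := le_trans (by gcongr) l1
      have i2 : Q * (1 - 18 * ε) ≤ T * M := le_trans (by gcongr) l2
      have j : 0 ≤ 1 - 18 * ε := by linarith
      -- A double-pair event needs two pins, each losing `18ε`; hence the constant `36`.
      calc P * (1 - 36 * ε) ≤ P * ((1 - 18 * ε) * (1 - 18 * ε)) := by
            gcongr; nlinarith
        _ = P * (1 - 18 * ε) * (1 - 18 * ε) := by ring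
        _ ≤ Q * M * (1 - 18 * ε) := by gcongr
        _ = Q * (1 - 18 * ε) * M := by ring
        _ ≤ T * M * M := by gcongr
        _ = T * M ^ 2 := by ring
    · rw [mul_one_div, mul_div_assoc', le_div_iff₀ (by positivity)]
      calc T * M ^ 2 = T * M * M := by ring
        _ ≤ Q * (1 + 10 * ε) * M := by gcongr
        _ = Q * M * (1 + 10 * ε) := by ring
        _ ≤ P * (1 + 10 * ε) * (1 + 10 * ε) := by gcongr
        _ = P * ((1 + 10 * ε) * (1 + 10 * ε)) := by ring
        _ ≤ P * (1 + 36 * ε) := by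
            gcongr; nlinarith

/-- The number of permutations avoiding a set of bad events. -/
theorem card_pinned_bounds (hb : LocalBounds a b J Δ h) (hΔ : 1 ≤ Δ)
    (hM : 36 * (h + Δ ^ 2) * 2 ≤ Fintype.card α) {F : Finset ((α × α) × (α × α))}
    (hF : F ⊆ badEvents a b J) :
    ((Fintype.card α).factorial : ℝ) * Real.exp (-((1 + 72 * (h + Δ ^ 2) / Fintype.card α) *
        ∑ e ∈ F, weight (Fintype.card α) e)) ≤ #(pinned (conflictOf F) ∅) ∧
      (#(pinned (conflictOf F) ∅) : ℝ) ≤ (Fintype.card α).factorial *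
        Real.exp (-((1 - 72 * (h + Δ ^ 2) / Fintype.card α) *
          ∑ e ∈ F, weight (Fintype.card α) e)) := by
  classical
  induction F using Finset.induction_on with
  | empty =>
    have : pinned (conflictOf (∅ : Finset ((α × α) × (α × α)))) ∅ = univ := by
      ext σ; simp [mem_pinned, conflictOf]
    rw [this, card_univ, Fintype.card_perm]
    simp
  | insert e F he ih =>
    obtain ⟨x, y⟩ := e
    have hF' : F ⊆ badEvents a b J := (subset_insert _ _).trans hF
    obtain ⟨ih1, ih2⟩ := ih hF'
    obtain ⟨e1, e2⟩ := card_pinned_event_bounds hb hΔ hM hF' (hF (mem_insert_self _ _)) he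
    have hcard : (#(pinned (conflictOf (insert (x, y) F)) ∅) : ℝ) +
      #(pinned (conflictOf F) {y, x}) = #(pinned (conflictOf F) ∅) := by
      exact_mod_cast card_pinned_conflictOf_insert F x y
    rw [sum_insert he]
    have hΔ2 : 1 ≤ Δ ^ 2 := Nat.one_le_pow _ _ hΔ
    have hM1 : (1 : ℝ) ≤ Fintype.card α := by
      have : 1 ≤ Fintype.card α := by omega
      exact_mod_cast this
    have hw0 : 0 ≤ weight (Fintype.card α) (x, y) := by unfold weight; split_ifs <;> positivity
    have hw1 : weight (Fintype.card α) (x, y) ≤ 1 / (Fintype.card α : ℝ) := by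
      unfold weight
      split_ifs
      · exact le_rfl
      · apply one_div_le_one_div_of_le (by linarith)
        nlinarith
    have hκM : 72 * ((h : ℝ) + (Δ : ℝ) ^ 2) ≤ (Fintype.card α : ℝ) := by
      have : 72 * (h + Δ ^ 2) ≤ Fintype.card α := by omega
      exact_mod_cast this
    have hκ1 : (1 : ℝ) ≤ (h : ℝ) + (Δ : ℝ) ^ 2 := by
      have : 1 ≤ h + Δ ^ 2 := by omega
      exact_mod_cast this
    set M : ℝ := (Fintype.card α : ℝ)
    set κ : ℝ := (h : ℝ) + (Δ : ℝ) ^ 2 with hκ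
    set w := weight (Fintype.card α) (x, y)
    set W := ∑ e ∈ F, weight (Fintype.card α) e
    set ε := κ / M with hε
    have hM0 : 0 < M := by linarith
    have r72 : 72 * κ / M = 72 * ε := by rw [hε]; ring
    have r36 : 36 * κ / M = 36 * ε := by rw [hε]; ring
    rw [r72] at ih1 ih2 ⊢
    rw [r36] at e1 e2
    have hε1 : 72 * ε ≤ 1 := by rw [hε, ← mul_div_assoc, div_le_one hM0]; exact hκM
    have hwε : w ≤ ε := hw1.trans (by rw [hε]; gcongr)
    have hε0 : 0 ≤ ε := by positivity
    set P : ℝ := ((#(pinned (conflictOf F) ∅) : ℕ) : ℝ)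
    have hP0 : 0 ≤ P := Nat.cast_nonneg _
    set T : ℝ := ((#(pinned (conflictOf F) {y, x}) : ℕ) : ℝ)
    have hN : (#(pinned (conflictOf (insert (x, y) F)) ∅) : ℝ) = P - T := by linarith
    rw [hN]
    constructor
    -- Passing from `36` to `72` leaves room `36εw`, which absorbs the quadratic term in `w` because
    -- `w ≤ 1/M ≤ ε`.
    · have k : Real.exp (-((1 + 72 * ε) * w)) ≤ 1 - (1 + 36 * ε) * w := by
        have hz0 : 0 ≤ (1 + 72 * ε) * w := by positivity
        have q : Real.exp (-((1 + 72 * ε) * w)) ≤ 1 / (1 + (1 + 72 * ε) * w) := by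
          rw [Real.exp_neg, ← one_div]
          apply one_div_le_one_div_of_le (by linarith)
          linarith [Real.add_one_le_exp ((1 + 72 * ε) * w)]
        refine q.trans ?_
        rw [div_le_iff₀ (by linarith)]
        have : (1 + 36 * ε) * (1 + 72 * ε) * w ≤ 36 * ε := by
          have : (1 + 36 * ε) * (1 + 72 * ε) ≤ 3 := by nlinarith
          nlinarith
        nlinarith [mul_le_mul_of_nonneg_right this hw0]
      calc ((Fintype.card α).factorial : ℝ) * Real.exp (-((1 + 72 * ε) * (w + W)))
          = ((Fintype.card α).factorial : ℝ) * Real.exp (-((1 + 72 * ε) * W)) *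
            Real.exp (-((1 + 72 * ε) * w)) := by
            rw [mul_assoc, ← Real.exp_add]; congr 2; ring
        _ ≤ P * (1 - (1 + 36 * ε) * w) := by gcongr
        _ ≤ P - T := by linarith
    · have k : 1 - (1 - 36 * ε) * w ≤ Real.exp (-((1 - 72 * ε) * w)) := by
        have := Real.add_one_le_exp (-((1 - 72 * ε) * w))
        nlinarith [mul_nonneg hε0 hw0]
      calc P - T ≤ P * (1 - (1 - 36 * ε) * w) := by linarith
        _ ≤ P * Real.exp (-((1 - 72 * ε) * w)) := by gcongr
        _ ≤ ((Fintype.card α).factorial : ℝ) * Real.exp (-((1 - 72 * ε) * W)) *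
            Real.exp (-((1 - 72 * ε) * w)) := by gcongr
        _ = ((Fintype.card α).factorial : ℝ) * Real.exp (-((1 - 72 * ε) * (w + W))) := by
            rw [mul_assoc, ← Real.exp_add]; congr 2; ring

end Events

/-! ### The total weight of the bad events -/

section Weights

variable {α V U : Type*} [Fintype α]

theorem card_offDiag_fibers [DecidableEq α] [Fintype V] [DecidableEq V] (a : α → V) :
    #{x : α × α | x.1 ≠ x.2 ∧ a x.1 = a x.2} = ∑ v, (#{p | a p = v}).descFactorial 2 := by
  rw [card_eq_sum_card_fiberwise (f := fun x : α × α => a x.1) (t := univ) (by simp)]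
  refine sum_congr rfl fun v _ => ?_
  have : ({x ∈ ({x : α × α | x.1 ≠ x.2 ∧ a x.1 = a x.2} : Finset (α × α)) | a x.1 = v}) =
      ({p | a p = v} : Finset α).offDiag := by
    ext ⟨p, q⟩
    simp only [mem_filter, mem_univ, true_and, mem_offDiag]
    constructor
    · rintro ⟨⟨h1, h2⟩, rfl⟩
      exact ⟨rfl, h2.symm, h1⟩
    · rintro ⟨rfl, h2, h1⟩
      exact ⟨⟨h1, h2.symm⟩, rfl⟩
  rw [this, offDiag_card]
  generalize #{p | a p = v} = c
  cases c <;> simp [Nat.descFactorial_succ, Nat.mul_succ, Nat.succ_mul]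

theorem two_mul_card_lt_fibers [LinearOrder α] [Fintype V] [DecidableEq V] (a : α → V) :
    2 * #{x : α × α | x.1 < x.2 ∧ a x.1 = a x.2} = ∑ v, (#{p | a p = v}).descFactorial 2 := by
  rw [← card_offDiag_fibers]
  have h1 : #{x : α × α | x.2 < x.1 ∧ a x.1 = a x.2} =
      #{x : α × α | x.1 < x.2 ∧ a x.1 = a x.2} := by
    refine card_bij (fun x _ => x.swap) ?_ ?_ ?_
    · rintro ⟨p, q⟩ h
      simpa [eq_comm] using h
    · rintro x _ y _ h
      exact Prod.swap_injective h
    · rintro ⟨p, q⟩ h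
      exact ⟨(q, p), by simpa [eq_comm] using h, rfl⟩
  rw [two_mul]
  nth_rewrite 2 [← h1]
  rw [← card_union_of_disjoint]
  · congr 1
    ext ⟨p, q⟩
    simp only [mem_union, mem_filter, mem_univ, true_and, ne_iff_lt_or_gt]
    tauto
  · rw [disjoint_left]
    rintro ⟨p, q⟩ h h'
    simp only [mem_filter, mem_univ, true_and] at h h'
    exact lt_asymm h.1 h'.1

theorem card_forbidden_eq [DecidableEq V] [DecidableEq U] (a : α → V) (b : α → U) (H : Finset (V × U)) :
    #{x : α × α | (a x.1, b x.2) ∈ H} = ∑ e ∈ H, #{p | a p = e.1} * #{q | b q = e.2} := by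
  rw [card_eq_sum_card_fiberwise (f := fun x : α × α => (a x.1, b x.2)) (t := H)
    (fun x hx => by simpa using hx)]
  refine sum_congr rfl fun e he => ?_
  rw [← card_product]
  congr 1
  ext ⟨p, q⟩
  simp only [mem_filter, mem_univ, true_and, mem_product]
  constructor
  · rintro ⟨-, rfl⟩
    exact ⟨rfl, rfl⟩
  · rintro ⟨h1, h2⟩
    have : (a p, b q) = e := Prod.ext h1 h2
    exact ⟨this ▸ he, this⟩

variable [LinearOrder α] {a : α → V} {b : α → U} {H : Finset (V × U)} {Δ h : ℕ}

/-- The permutations that project to a simple graph avoiding `H`. -/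
theorem mem_pinned_badEvents {σ : Perm α} :
    σ ∈ pinned (conflictOf (badEvents a b (fun x => (a x.1, b x.2) ∈ H))) ∅ ↔
      Function.Injective (fun p => (a p, b (σ p))) ∧ ∀ p, (a p, b (σ p)) ∉ H := by
  rw [mem_pinned]
  constructor
  · rintro ⟨-, hσ⟩
    have hH : ∀ p, (a p, b (σ p)) ∉ H := fun p hp =>
      hσ (p, σ p) (p, σ p) (Or.inl (mem_badEvents.2 (Or.inl ⟨rfl, hp⟩))) rfl rfl
    have key : ∀ p p', p < p' → a p = a p' → b (σ p) = b (σ p') → False := by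
      intro p p' hlt h1 h2
      refine hσ (p, σ p) (p', σ p') (Or.inl (mem_badEvents.2 (Or.inr ?_))) rfl rfl
      exact ⟨hlt, fun e => hlt.ne (σ.injective e), h1, h2, hH p, hH p'⟩
    refine ⟨fun p p' hpp' => ?_, hH⟩
    simp only [Prod.mk.injEq] at hpp'
    rcases lt_trichotomy p p' with hlt | heq | hlt
    · exact (key p p' hlt hpp'.1 hpp'.2).elim
    · exact heq
    · exact (key p' p hlt hpp'.1.symm hpp'.2.symm).elim
  · rintro ⟨hinj, hH⟩
    refine ⟨by simp, ?_⟩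
    have key : ∀ x y, (x, y) ∈ badEvents a b (fun x => (a x.1, b x.2) ∈ H) →
        σ x.1 = x.2 → σ y.1 = y.2 → False := by
      intro x y hxy hx hy
      rcases mem_badEvents.1 hxy with ⟨-, hJ⟩ | ⟨h1, -, h3, h4, -⟩
      · rw [← hx] at hJ; exact hH _ hJ
      · rw [← hx, ← hy] at h4
        exact h1.ne (hinj (Prod.ext h3 h4))
    rintro x y (hxy | hxy) hx hy
    · exact key x y hxy hx hy
    · exact key y x hxy hy hx

variable [Fintype V] [Fintype U] [DecidableEq V] [DecidableEq U]

/-- The total weight of the bad events, up to a small error, and a crude bound for it. -/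
theorem sum_weight_badEvents (hb : LocalBounds a b (fun x => (a x.1, b x.2) ∈ H) Δ h)
    (hM : 0 < Fintype.card α) :
    |∑ e ∈ badEvents a b (fun x => (a x.1, b x.2) ∈ H), weight (Fintype.card α) e -
        ((∑ e ∈ H, (#{p | a p = e.1} : ℝ) * #{q | b q = e.2}) / Fintype.card α +
          ((∑ v, (#{p | a p = v}).descFactorial 2 : ℕ) : ℝ) *
            ((∑ u, (#{q | b q = u}).descFactorial 2 : ℕ) : ℝ) / (2 * (Fintype.card α : ℝ) ^ 2))| ≤
      (h : ℝ) * (Δ : ℝ) ^ 2 / Fintype.card α ∧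
    ∑ e ∈ badEvents a b (fun x => (a x.1, b x.2) ∈ H), weight (Fintype.card α) e ≤
      (h : ℝ) + (Δ : ℝ) ^ 2 ∧
    0 ≤ ∑ e ∈ badEvents a b (fun x => (a x.1, b x.2) ∈ H), weight (Fintype.card α) e := by
  classical
  set J : α × α → Prop := fun x => (a x.1, b x.2) ∈ H with hJ
  set M := Fintype.card α with hMdef
  have hM0 : (0 : ℝ) < M := by exact_mod_cast hM
  set D : Finset ((α × α) × (α × α)) := {e | e.1.1 < e.2.1 ∧ e.1.2 ≠ e.2.2 ∧
    a e.1.1 = a e.2.1 ∧ b e.1.2 = b e.2.2} with hD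
  have hw : ∑ e ∈ badEvents a b J, weight M e =
      (#{x | J x} : ℝ) / M + (#{e ∈ D | ¬ J e.1} : ℝ) / M ^ 2 := by
    rw [← sum_filter_add_sum_filter_not _ (fun e : (α × α) × (α × α) => e.1 = e.2)]
    congr 1
    · have : ({e ∈ badEvents a b J | e.1 = e.2} : Finset ((α × α) × (α × α))) =
          ({x | J x} : Finset (α × α)).image fun x => (x, x) := by
        ext ⟨x, y⟩
        simp only [mem_filter, mem_badEvents, mem_image, mem_univ, true_and, Prod.mk.injEq]
        constructor
        · rintro ⟨⟨-, h⟩ | h, rfl⟩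
          · exact ⟨x, h, rfl, rfl⟩
          · exact absurd h.1 (lt_irrefl _)
        · rintro ⟨z, hz, rfl, rfl⟩
          exact ⟨Or.inl ⟨rfl, hz⟩, rfl⟩
      rw [this, sum_image (fun _ _ _ _ h => congrArg Prod.fst h)]
      simp [weight, div_eq_mul_inv]
    · have : ({e ∈ badEvents a b J | ¬ e.1 = e.2} : Finset ((α × α) × (α × α))) =
          {e ∈ D | ¬ J e.1} := by
        ext ⟨x, y⟩
        simp only [mem_filter, mem_badEvents, hD, mem_univ, true_and]
        constructor
        · rintro ⟨⟨rfl, h⟩ | ⟨h1, h2, h3, h4, h5, h6⟩, h⟩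
          · exact absurd rfl h
          · exact ⟨⟨h1, h2, h3, h4⟩, h5⟩
        · rintro ⟨⟨h1, h2, h3, h4⟩, h5⟩
          refine ⟨Or.inr ⟨h1, h2, h3, h4, h5, ?_⟩, fun e => h1.ne (by rw [e])⟩
          rw [hJ] at h5 ⊢
          simpa [← h3, ← h4] using h5
      rw [this, sum_congr rfl (g := fun _ => 1 / (M : ℝ) ^ 2)]
      · simp [div_eq_mul_inv]
      · intro e he
        simp only [mem_filter, hD, mem_univ, true_and] at he
        exact if_neg fun h => he.1.1.ne (by rw [h])
  -- Only the first points are ordered, while the second points are merely distinct; this gives the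
  -- `1/2` in `S₂T₂ / (2M²)`.
  have hDcard : 2 * #D = (∑ v, (#{p | a p = v}).descFactorial 2) *
      (∑ u, (#{q | b q = u}).descFactorial 2) := by
    rw [← two_mul_card_lt_fibers, ← card_offDiag_fibers, mul_assoc, ← card_product]
    congr 1
    refine card_bij (fun e _ => ((e.1.1, e.2.1), (e.1.2, e.2.2))) ?_ ?_ ?_
    · rintro ⟨⟨p, q⟩, ⟨p', q'⟩⟩ h
      simp only [mem_filter, hD, mem_univ, true_and] at h
      simp only [mem_product, mem_filter, mem_univ, true_and]
      exact ⟨⟨h.1, h.2.2.1⟩, h.2.1, h.2.2.2⟩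
    · rintro ⟨⟨p, q⟩, ⟨p', q'⟩⟩ _ ⟨⟨r, s⟩, ⟨r', s'⟩⟩ _ h
      simp only [Prod.mk.injEq] at h ⊢
      tauto
    · rintro ⟨⟨p, p'⟩, ⟨q, q'⟩⟩ h
      simp only [mem_product, mem_filter, mem_univ, true_and] at h
      refine ⟨((p, q), (p', q')), ?_, rfl⟩
      simp only [mem_filter, hD, mem_univ, true_and]
      exact ⟨h.1.1, h.2.1, h.1.2, h.2.2⟩
  have hfor : #{x | J x} ≤ M * h := by
    have := hb.card_forbidden_le
    convert this
  have hsub : ∀ S : Finset (α × α), #{e ∈ D | e.1 ∈ S} ≤ #S * Δ ^ 2 := by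
    intro S
    have : {e ∈ D | e.1 ∈ S} ⊆ S.biUnion fun x => (sameCells a b x).image fun y => (x, y) := by
      rintro ⟨x, y⟩ he
      simp only [mem_filter, hD, mem_univ, true_and] at he
      simp only [mem_biUnion, mem_image, Prod.mk.injEq]
      exact ⟨x, he.2, y, mem_sameCells.2 ⟨he.1.2.2.1.symm, he.1.2.2.2.symm⟩, rfl, rfl⟩
    exact (card_le_card this).trans (card_biUnion_le_card_mul _ _ _ fun x _ =>
      card_image_le.trans (hb.card_sameCells_le x))
  have hDJ : #{e ∈ D | J e.1} ≤ M * h * Δ ^ 2 := by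
    have := hsub {x | J x}
    simp only [mem_filter, mem_univ, true_and] at this
    exact this.trans (Nat.mul_le_mul_right _ hfor)
  have hDn : #{e ∈ D | ¬ J e.1} ≤ M ^ 2 * Δ ^ 2 := by
    have := hsub univ
    simp only [mem_univ, filter_true, card_univ, Fintype.card_prod, ← sq] at this
    exact (card_filter_le _ _).trans this
  have hDsplit := card_filter_add_card_filter_not (s := D) (fun e => J e.1)
  have e1 : (∑ e ∈ H, (#{p | a p = e.1} : ℝ) * #{q | b q = e.2}) = #{x | J x} := by
    have h1 : #{x | J x} = ∑ e ∈ H, #{p | a p = e.1} * #{q | b q = e.2} := by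
      rw [← card_forbidden_eq]
    exact_mod_cast h1.symm
  have e2 : ((∑ v, (#{p | a p = v}).descFactorial 2 : ℕ) : ℝ) *
      ((∑ u, (#{q | b q = u}).descFactorial 2 : ℕ) : ℝ) =
      2 * (#{e ∈ D | J e.1} + #{e ∈ D | ¬ J e.1}) := by
    have : (∑ v, (#{p | a p = v}).descFactorial 2) *
      (∑ u, (#{q | b q = u}).descFactorial 2) =
        2 * (#{e ∈ D | J e.1} + #{e ∈ D | ¬ J e.1}) := by rw [hDsplit, hDcard]
    exact_mod_cast this
  have hforR : (#{x | J x} : ℝ) ≤ M * h := by exact_mod_cast hfor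
  have hDJR : (#{e ∈ D | J e.1} : ℝ) ≤ M * h * Δ ^ 2 := by exact_mod_cast hDJ
  have hDnR : (#{e ∈ D | ¬ J e.1} : ℝ) ≤ M ^ 2 * Δ ^ 2 := by exact_mod_cast hDn
  rw [hw, e1, e2]
  refine ⟨?_, ?_, by positivity⟩
  -- The discrepancy is exactly the weight of the double pairs over forbidden cells: at most `Mh`
  -- forbidden pairs, each with at most `Δ²` partners.
  · have : (#{x | J x} : ℝ) / M + (#{e ∈ D | ¬ J e.1} : ℝ) / M ^ 2 - ((#{x | J x} : ℝ) / M +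
        2 * (#{e ∈ D | J e.1} + #{e ∈ D | ¬ J e.1}) / (2 * (M : ℝ) ^ 2)) =
        - ((#{e ∈ D | J e.1} : ℝ) / M ^ 2) := by
      field_simp; ring
    rw [this, abs_neg, abs_of_nonneg (by positivity), div_le_div_iff₀ (by positivity) hM0]
    nlinarith
  · have i1 : (#{x | J x} : ℝ) / M ≤ h := by
      rw [div_le_iff₀ hM0]; linarith
    have i2 : (#{e ∈ D | ¬ J e.1} : ℝ) / M ^ 2 ≤ Δ ^ 2 := by
      rw [div_le_iff₀ (by positivity)]; linarith
    linarith

/-- The number of permutations that project to a simple graph avoiding `H`. -/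
theorem card_simple_bounds (hb : LocalBounds a b (fun x => (a x.1, b x.2) ∈ H) Δ h) (hΔ : 1 ≤ Δ)
    (hM : 36 * (h + Δ ^ 2) * 2 ≤ Fintype.card α) {lam η : ℝ}
    (hlam : lam = (∑ e ∈ H, (#{p | a p = e.1} : ℝ) * #{q | b q = e.2}) / Fintype.card α +
          ((∑ v, (#{p | a p = v}).descFactorial 2 : ℕ) : ℝ) *
            ((∑ u, (#{q | b q = u}).descFactorial 2 : ℕ) : ℝ) / (2 * (Fintype.card α : ℝ) ^ 2))
    (hη : η = 73 * ((h : ℝ) + Δ ^ 2) ^ 2 / Fintype.card α) :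
    ((Fintype.card α).factorial : ℝ) * Real.exp (-lam - η) ≤
        #(pinned (conflictOf (badEvents a b (fun x => (a x.1, b x.2) ∈ H))) ∅) ∧
      (#(pinned (conflictOf (badEvents a b (fun x => (a x.1, b x.2) ∈ H))) ∅) : ℝ) ≤
        ((Fintype.card α).factorial : ℝ) * Real.exp (-lam + η) := by
  have hΔ2 : 1 ≤ Δ ^ 2 := Nat.one_le_pow _ _ hΔ
  have hMpos : 0 < Fintype.card α := by omega
  obtain ⟨w1, w2, w3⟩ := sum_weight_badEvents hb hMpos
  obtain ⟨b1, b2⟩ := card_pinned_bounds hb hΔ hM (subset_refl _)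
  rw [← hlam] at w1
  set W := ∑ e ∈ badEvents a b (fun x => (a x.1, b x.2) ∈ H), weight (Fintype.card α) e
  have hM0 : (0 : ℝ) < Fintype.card α := by exact_mod_cast hMpos
  set M : ℝ := (Fintype.card α : ℝ)
  have i1 : 72 * ((h : ℝ) + Δ ^ 2) / M * W ≤ 72 * ((h : ℝ) + Δ ^ 2) ^ 2 / M := by
    calc 72 * ((h : ℝ) + Δ ^ 2) / M * W ≤ 72 * ((h : ℝ) + Δ ^ 2) / M * (h + Δ ^ 2) := by gcongr
      _ = _ := by ring
  have i2 : (h : ℝ) * Δ ^ 2 / M ≤ ((h : ℝ) + Δ ^ 2) ^ 2 / M := by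
    gcongr
    have : (0 : ℝ) ≤ h := Nat.cast_nonneg _
    nlinarith [sq_nonneg (Δ : ℝ), mul_nonneg this (sq_nonneg (Δ : ℝ)), sq_nonneg ((Δ : ℝ) ^ 2)]
  -- The `72` is the relative error applied to a total weight of at most `κ`; the remaining `1`
  -- covers the omitted double pairs.
  have i3 : η = 72 * ((h : ℝ) + Δ ^ 2) ^ 2 / M + ((h : ℝ) + Δ ^ 2) ^ 2 / M := by
    rw [hη]; ring
  have w1' := abs_le.1 w1
  constructor
  · refine le_trans ?_ b1
    gcongr
    linarith [w1'.1, w1'.2]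
  · refine b2.trans ?_
    gcongr
    linarith [w1'.1, w1'.2]

end Weights

/-! ### From permutations to simple bipartite graphs -/

section Counting

/-- The number of bijections that respect two maps with fibers of the same sizes. -/
theorem card_fiberwise_equiv {α β V : Type*} [Fintype α] [Fintype β] [Fintype V] [DecidableEq α]
    [DecidableEq β] [DecidableEq V] (f : α → V) (g : β → V)
    (hfg : ∀ v, #{p | f p = v} = #{x | g x = v}) :
    Fintype.card {e : α ≃ β // ∀ p, g (e p) = f p} = ∏ v, (#{p | f p = v}).factorial := by
  have hne : ∀ v, Nonempty ({p // f p = v} ≃ {x // g x = v}) := fun v => by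
    refine ⟨Fintype.equivOfCardEq ?_⟩
    rw [Fintype.card_subtype, Fintype.card_subtype, hfg]
  let e₀ : α ≃ β := Equiv.ofFiberEquiv fun v => (hne v).some
  have he₀ : ∀ p, g (e₀ p) = f p := fun p => Equiv.ofFiberEquiv_map _ p
  have h1 : Fintype.card {e : α ≃ β // ∀ p, g (e p) = f p} =
      Fintype.card {σ : Perm α // f ∘ σ = f} := by
    refine Fintype.card_congr
      { toFun := fun e => ⟨e.1.trans e₀.symm, ?_⟩
        invFun := fun σ => ⟨σ.1.trans e₀, ?_⟩
        left_inv := ?_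
        right_inv := ?_ }
    · funext p
      simp only [Function.comp_apply, Equiv.trans_apply]
      rw [← he₀, Equiv.apply_symm_apply, e.2]
    · intro p
      rw [Equiv.trans_apply, he₀]
      exact congrFun σ.2 p
    · intro e
      ext p
      simp
    · intro σ
      ext p
      simp
  rw [h1, DomMulAct.stabilizer_card]
  simp only [Fintype.card_subtype]

theorem card_filter_coe {β : Type*} (G : Finset β) (P : β → Prop) [DecidablePred P] :
    #{x : G | P x.1} = #(G.filter P) := by
  rw [← card_map (Function.Embedding.subtype (· ∈ G))]
  congr 1
  ext x
  simp [and_comm]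

variable {α : Type*} [Fintype α] [DecidableEq α] {n m : ℕ}

/-- The bipartite graph obtained by projecting a pairing. -/
def project (a : α → Fin n) (b : α → Fin m) (σ : Perm α) : BipGraph n m :=
  univ.image fun p => (a p, b (σ p))

/-- Such a `σ` factors uniquely as `e₂⁻¹ ∘ e₁`, where `e₁` and `e₂` label the edges of `G` by the
points of the two sides, compatibly with `a` and `b`. The labellings are counted by
`card_fiberwise_equiv`. -/
theorem card_project_fiber (a : α → Fin n) (b : α → Fin m) (G : BipGraph n m)
    (hG : HasDegrees G (fun v => #{p | a p = v}) (fun u => #{q | b q = u})) :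
    #{σ : Perm α | Function.Injective (fun p => (a p, b (σ p))) ∧ project a b σ = G} =
      (∏ v, (#{p | a p = v}).factorial) * ∏ u, (#{q | b q = u}).factorial := by
  classical
  have c1 : ∀ v, #{p | a p = v} = #{x : G | x.1.1 = v} := by
    intro v
    rw [card_filter_coe G (fun e => e.1 = v)]
    exact (hG.1 v).symm
  have c2 : ∀ u, #{q | b q = u} = #{x : G | x.1.2 = u} := by
    intro u
    rw [card_filter_coe G (fun e => e.2 = u)]
    exact (hG.2 u).symm
  rw [← card_fiberwise_equiv a (fun x : G => x.1.1) c1,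
    ← card_fiberwise_equiv b (fun x : G => x.1.2) c2, ← Fintype.card_prod,
    ← Fintype.card_subtype]
  symm
  refine Fintype.card_of_bijective (f := fun e => ⟨e.1.1.trans e.2.1.symm, ?_⟩) ⟨?_, ?_⟩
  · have key : ∀ p, (a p, b ((e.1.1.trans e.2.1.symm) p)) = (e.1.1 p).1 := by
      intro p
      refine Prod.ext (e.1.2 p).symm ?_
      rw [← e.2.2]
      simp
    simp only [key, project]
    refine ⟨Subtype.val_injective.comp e.1.1.injective, ?_⟩
    ext x
    simp only [mem_image, mem_univ, true_and]
    constructor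
    · rintro ⟨p, rfl⟩
      exact (e.1.1 p).2
    · intro hx
      exact ⟨e.1.1.symm ⟨x, hx⟩, by simp⟩
  · rintro ⟨⟨e₁, h₁⟩, ⟨e₂, h₂⟩⟩ ⟨⟨f₁, k₁⟩, ⟨f₂, k₂⟩⟩ h
    simp only [Subtype.mk.injEq] at h
    have key : e₁ = f₁ := by
      ext1 p
      apply Subtype.ext
      refine Prod.ext ((h₁ p).trans (k₁ p).symm) ?_
      have i1 := h₂ ((e₁.trans e₂.symm) p)
      have i2 := k₂ ((f₁.trans f₂.symm) p)
      rw [h] at i1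
      have := i1.trans i2.symm
      rw [← h] at this
      nth_rewrite 2 [h] at this
      simpa using this
    subst key
    have : e₂ = f₂ := by
      have h' : e₂.symm = f₂.symm := by
        ext1 x
        have := DFunLike.congr_fun h (e₁.symm x)
        simpa using this
      rw [← Equiv.symm_symm e₂, h', Equiv.symm_symm]
    subst this
    rfl
  · rintro ⟨σ, hinj, hσ⟩
    have hmem : ∀ p, (a p, b (σ p)) ∈ G := fun p => by
      rw [← hσ]; exact mem_image_of_mem _ (mem_univ p)
    let e₁ : α ≃ G := Equiv.ofBijective (fun p => ⟨(a p, b (σ p)), hmem p⟩) ⟨fun p p' h =>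
      hinj (congrArg Subtype.val h), fun x => by
        have hx : x.1 ∈ project a b σ := hσ.symm ▸ x.2
        obtain ⟨p, -, hp⟩ := mem_image.1 hx
        exact ⟨p, Subtype.ext hp⟩⟩
    refine ⟨⟨⟨e₁, fun p => rfl⟩, ⟨σ.symm.trans e₁, fun q => ?_⟩⟩, ?_⟩
    · change b (σ (σ.symm q)) = b q
      rw [Equiv.apply_symm_apply]
    · apply Subtype.ext
      ext1 p
      simp

open Classical in
theorem card_simple_eq (a : α → Fin n) (b : α → Fin m) (H : BipGraph n m) :
    #{σ : Perm α | Function.Injective (fun p => (a p, b (σ p))) ∧ ∀ p, (a p, b (σ p)) ∉ H} =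
      #{G : BipGraph n m | HasDegrees G (fun v => #{p | a p = v}) (fun u => #{q | b q = u}) ∧
        Disjoint G H} *
      ((∏ v, (#{p | a p = v}).factorial) * ∏ u, (#{q | b q = u}).factorial) := by
  rw [card_eq_sum_card_fiberwise (f := project a b) (t := {G : BipGraph n m |
    HasDegrees G (fun v => #{p | a p = v}) (fun u => #{q | b q = u}) ∧ Disjoint G H})]
  · rw [← smul_eq_mul, ← sum_const]
    refine sum_congr rfl fun G hG => ?_
    rw [mem_filter] at hG
    rw [← card_project_fiber a b G hG.2.1]
    congr 1
    ext σ
    simp only [mem_filter, mem_univ, true_and]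
    constructor
    · rintro ⟨⟨h1, -⟩, h2⟩
      exact ⟨h1, h2⟩
    · rintro ⟨h1, rfl⟩
      refine ⟨⟨h1, fun p hp => ?_⟩, rfl⟩
      exact disjoint_left.1 hG.2.2 (mem_image_of_mem _ (mem_univ p)) hp
  · intro σ hσ
    simp only [coe_filter, mem_univ, true_and, Set.mem_ofPred_eq] at hσ ⊢
    obtain ⟨h1, h2⟩ := hσ
    refine ⟨⟨fun v => ?_, fun u => ?_⟩, ?_⟩
    · rw [degLeft, project, filter_image, card_image_of_injective _ h1]
    · rw [degRight, project, filter_image, card_image_of_injective _ h1]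
      refine card_bij (fun p _ => σ p) ?_ ?_ ?_
      · intro p hp
        simpa using hp
      · intro p _ q _ h
        exact σ.injective h
      · intro q hq
        exact ⟨σ.symm q, by simpa using hq, by simp⟩
    · rw [disjoint_left]
      intro x hx
      obtain ⟨p, -, rfl⟩ := mem_image.1 hx
      exact h2 p

end Counting

/-! ### Counting around a fixed second graph, then summing over it -/

section Enumeration

variable {n m : ℕ}

theorem exists_cell_map {k : ℕ} (s : Fin k → ℕ) {M : ℕ} (hM : total s = M) :
    ∃ a : Fin M → Fin k, ∀ v, #{p | a p = v} = s v := by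
  have e : Fin M ≃ Σ v, Fin (s v) := Fintype.equivOfCardEq (by simp [← hM, total])
  refine ⟨fun p => (e p).1, fun v => ?_⟩
  have : #{p | (e p).1 = v} = #(univ : Finset (Fin (s v))) := by
    symm
    refine card_bij (fun i _ => e.symm ⟨v, i⟩) ?_ ?_ ?_
    · intro i _
      simp
    · intro i _ j _ h
      simpa using h
    · intro p hp
      simp only [mem_filter, mem_univ, true_and] at hp
      refine ⟨hp ▸ (e p).2, mem_univ _, ?_⟩
      subst hp
      simp
  rw [this, card_univ, Fintype.card_fin]

open Classical in
/-- The bipartite graphs with degrees `(s, t)` that are edge-disjoint from `H`. -/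
noncomputable def disjointFrom (s : Fin n → ℕ) (t : Fin m → ℕ) (H : BipGraph n m) :
    Finset (BipGraph n m) :=
  {G | HasDegrees G s t ∧ Disjoint G H}

/-- The pairing estimate applies with `h = d * Δ`: the cell of a point has at most `d` neighbours in
`H`, each a cell of at most `Δ` points. -/
theorem card_disjointFrom_bounds {s : Fin n → ℕ} {t : Fin m → ℕ} {H : BipGraph n m} {Δ d : ℕ}
    (hst : total s = total t) (hs : ∀ v, s v ≤ Δ) (ht : ∀ u, t u ≤ Δ)
    (hl : ∀ v, degLeft H v ≤ d) (hr : ∀ u, degRight H u ≤ d) (hΔ : 1 ≤ Δ)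
    (hM : 36 * (d * Δ + Δ ^ 2) * 2 ≤ total s) {c lam η : ℝ}
    (hc : c = ((total s).factorial : ℝ) /
      ((∏ v, ((s v).factorial : ℝ)) * ∏ u, ((t u).factorial : ℝ)))
    (hlam : lam = (∑ e ∈ H, (s e.1 : ℝ) * t e.2) / total s +
      (fallTwo s : ℝ) * fallTwo t / (2 * (total s : ℝ) ^ 2))
    (hη : η = 73 * ((d : ℝ) * Δ + Δ ^ 2) ^ 2 / total s) :
    c * Real.exp (-lam - η) ≤ #(disjointFrom s t H) ∧
      (#(disjointFrom s t H) : ℝ) ≤ c * Real.exp (-lam + η) := by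
  classical
  obtain ⟨a, ha⟩ := exists_cell_map s rfl
  obtain ⟨b, hb⟩ := exists_cell_map t hst.symm
  have hloc : LocalBounds a b (fun x => (a x.1, b x.2) ∈ H) Δ (d * Δ) := by
    refine ⟨fun p => ?_, fun q => ?_, fun p => ?_, fun q => ?_⟩
    · convert (ha (a p)).trans_le (hs _)
    · convert (hb (b q)).trans_le (ht _)
    · have : ({q | (a p, b q) ∈ H} : Finset (Fin (total s))) ⊆
          (H.filter fun e => e.1 = a p).biUnion fun e => {q | b q = e.2} := by
        intro q hq
        simp only [mem_filter, mem_univ, true_and] at hq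
        simp only [mem_biUnion, mem_filter, mem_univ, true_and]
        exact ⟨_, ⟨hq, rfl⟩, rfl⟩
      refine le_trans (le_of_eq (by congr!)) <| (card_le_card this).trans ((card_biUnion_le_card_mul _ _ Δ
        fun e _ => (hb e.2).trans_le (ht _)).trans (Nat.mul_le_mul_right _ (hl _)))
    · have : ({p | (a p, b q) ∈ H} : Finset (Fin (total s))) ⊆
          (H.filter fun e => e.2 = b q).biUnion fun e => {p | a p = e.1} := by
        intro p hp
        simp only [mem_filter, mem_univ, true_and] at hp
        simp only [mem_biUnion, mem_filter, mem_univ, true_and]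
        exact ⟨_, ⟨hp, rfl⟩, rfl⟩
      refine le_trans (le_of_eq (by congr!)) <| (card_le_card this).trans ((card_biUnion_le_card_mul _ _ Δ
        fun e _ => (ha e.1).trans_le (hs _)).trans (Nat.mul_le_mul_right _ (hr _)))
  have hcount : #(pinned (conflictOf (badEvents a b (fun x => (a x.1, b x.2) ∈ H))) ∅) =
      #(disjointFrom s t H) * ((∏ v, (s v).factorial) * ∏ u, (t u).factorial) := by
    have := card_simple_eq a b H
    simp only [ha, hb] at this
    rw [disjointFrom, ← this]
    congr 1
    ext σ
    rw [mem_pinned_badEvents]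
    simp
  have hbound := card_simple_bounds (lam := lam) (η := η) hloc hΔ (by simpa using hM)
    (by rw [hlam]; simp only [ha, hb, Fintype.card_fin, fallTwo])
    (by rw [hη]; simp)
  rw [hcount, Fintype.card_fin] at hbound
  push_cast at hbound
  set P : ℝ := (∏ v, ((s v).factorial : ℝ)) * ∏ u, ((t u).factorial : ℝ)
  have hP : 0 < P := by positivity
  rw [hc, div_mul_eq_mul_div, div_mul_eq_mul_div, div_le_iff₀ hP, le_div_iff₀ hP]
  exact hbound

theorem irregularity_nonneg {k : ℕ} (a : Fin k → ℕ) : 0 ≤ irregularity a :=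
  sum_nonneg fun _ _ => abs_nonneg _

/-- A bilinear degree sum is close to its average, by irregularity of the first vector. -/
theorem abs_edge_sum_sub_le {ι : Type*} {E : Finset ι} {π : ι → Fin n} {ρ : ι → Fin m}
    {x : Fin n → ℕ} {y : Fin m → ℕ} (hx : ∀ v, #{e ∈ E | π e = v} = x v)
    (hy : ∀ u, #{e ∈ E | ρ e = u} = y u) (s : Fin n → ℕ) (t : Fin m → ℕ) {M : ℝ} (hM : 0 < M)
    (hX : 0 < total x) :
    |(∑ e ∈ E, (s (π e) : ℝ) * t (ρ e)) / M -
      ((∑ v, (s v : ℝ) * x v) * ∑ u, (t u : ℝ) * y u) / (M * total x)| ≤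
      2 * (irregularity s * maxEntry t * maxEntry x / M) := by
  have hπ : ∀ f : Fin n → ℝ, ∑ e ∈ E, f (π e) = ∑ v, f v * x v := by
    intro f
    rw [← sum_fiberwise E π]
    refine sum_congr rfl fun v _ => ?_
    rw [sum_congr rfl (g := fun _ => f v) (fun e he => by rw [(mem_filter.1 he).2]), sum_const,
      hx, nsmul_eq_mul, mul_comm]
  have hρ : ∀ f : Fin m → ℝ, ∑ e ∈ E, f (ρ e) = ∑ u, f u * y u := by
    intro f
    rw [← sum_fiberwise E ρ]
    refine sum_congr rfl fun v _ => ?_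
    rw [sum_congr rfl (g := fun _ => f v) (fun e he => by rw [(mem_filter.1 he).2]), sum_const,
      hy, nsmul_eq_mul, mul_comm]
  have hX0 : (0 : ℝ) < total x := by exact_mod_cast hX
  have hXsum : (total x : ℝ) = ∑ v, (x v : ℝ) := by simp [total]
  have hEX : (#E : ℝ) = total x := by
    have := hπ (fun _ => 1)
    simpa [hXsum] using this
  have htm : ∀ u, (t u : ℝ) ≤ maxEntry t := fun u => by
    exact_mod_cast le_sup (f := t) (mem_univ u)
  have hxm : ∀ v, (x v : ℝ) ≤ maxEntry x := fun v => by
    exact_mod_cast le_sup (f := x) (mem_univ v)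
  set c := average s
  set TY := ∑ u, (t u : ℝ) * y u with hTY
  have hTY0 : 0 ≤ TY := by positivity
  have hTYle : TY ≤ maxEntry t * total x := by
    rw [hTY, ← hρ (fun u => (t u : ℝ)), ← hEX]
    calc ∑ e ∈ E, (t (ρ e) : ℝ) ≤ ∑ _e ∈ E, (maxEntry t : ℝ) := sum_le_sum fun e _ => htm _
      _ = maxEntry t * #E := by rw [sum_const, nsmul_eq_mul, mul_comm]
  have hcx : ∑ v, |(s v : ℝ) - c| * x v ≤ irregularity s * maxEntry x := by
    rw [irregularity, sum_mul]
    exact sum_le_sum fun v _ => mul_le_mul_of_nonneg_left (hxm v) (abs_nonneg _)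
  -- After centring `s` at `c`, the constant part contributes `c * TY / M` to both quantities and
  -- cancels. What remains of each is at most `irregularity s * maxEntry x * maxEntry t / M`, whence
  -- the factor `2`.
  set D₁ := ∑ e ∈ E, ((s (π e) : ℝ) - c) * t (ρ e) with hD₁
  set D₂ := ∑ v, ((s v : ℝ) - c) * x v with hD₂
  have e1 : ∑ e ∈ E, (s (π e) : ℝ) * t (ρ e) = D₁ + c * TY := by
    rw [hTY, ← hρ (fun u => (t u : ℝ)), mul_sum, hD₁, ← sum_add_distrib]
    exact sum_congr rfl fun e _ => by ring
  have e2 : ∑ v, (s v : ℝ) * x v = D₂ + c * total x := by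
    rw [hXsum, mul_sum, hD₂, ← sum_add_distrib]
    exact sum_congr rfl fun e _ => by ring
  have b1 : |D₁| ≤ irregularity s * maxEntry x * maxEntry t := by
    calc |D₁| ≤ ∑ e ∈ E, |((s (π e) : ℝ) - c) * t (ρ e)| := abs_sum_le_sum_abs _ _
      _ ≤ ∑ e ∈ E, |(s (π e) : ℝ) - c| * maxEntry t := by
          refine sum_le_sum fun e _ => ?_
          rw [abs_mul, Nat.abs_cast]
          exact mul_le_mul_of_nonneg_left (htm _) (abs_nonneg _)
      _ = (∑ v, |(s v : ℝ) - c| * x v) * maxEntry t := by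
          rw [← sum_mul, hπ (fun v => |(s v : ℝ) - c|)]
      _ ≤ _ := by gcongr
  have b2 : |D₂| ≤ irregularity s * maxEntry x := by
    refine (abs_sum_le_sum_abs _ _).trans (le_trans (le_of_eq ?_) hcx)
    exact sum_congr rfl fun v _ => by rw [abs_mul, Nat.abs_cast]
  have e3 : (D₁ + c * TY) / M - ((D₂ + c * total x) * TY) / (M * total x) =
      (D₁ - D₂ * TY / total x) / M := by
    field_simp; ring
  rw [e1, e2, e3, abs_div, abs_of_pos hM, ← mul_div_assoc]
  gcongr
  have hirr := irregularity_nonneg s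
  have b3 : |D₂ * TY / total x| ≤ irregularity s * maxEntry x * maxEntry t := by
    rw [abs_div, abs_mul, abs_of_nonneg hTY0, abs_of_pos hX0, div_le_iff₀ hX0]
    calc |D₂| * TY ≤ irregularity s * maxEntry x * (maxEntry t * total x) := by gcongr
      _ = _ := by ring
  have := abs_sub D₁ (D₂ * TY / total x)
  linarith

/-- Disjointness from `∅` is vacuous, so one definition counts both the second graphs and the first
graphs around them. -/
theorem BP_eq_sum (s : Fin n → ℕ) (t : Fin m → ℕ) (x : Fin n → ℕ) (y : Fin m → ℕ) :
    BP s t x y = ∑ H ∈ disjointFrom x y ∅, #(disjointFrom s t H) := by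
  classical
  rw [BP, card_eq_sum_card_fiberwise (f := Prod.snd) (t := disjointFrom x y ∅)]
  · refine sum_congr rfl fun H hH => ?_
    have hH' : HasDegrees H x y := (mem_filter.1 hH).2.1
    refine card_bij (fun p _ => p.1) ?_ ?_ ?_
    · rintro ⟨G, K⟩ h
      simp only [mem_filter, mem_univ, true_and] at h
      obtain ⟨⟨h1, -, h3⟩, rfl⟩ := h
      simp [disjointFrom, h1, h3]
    · rintro ⟨G, K⟩ h ⟨G', K'⟩ h' e
      simp only [mem_filter, mem_univ, true_and] at h h' e
      rw [e, h.2, h'.2]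
    · intro G hG
      simp only [disjointFrom, mem_filter, mem_univ, true_and] at hG
      exact ⟨(G, H), by simp [hG.1, hG.2, hH'], rfl⟩
  · rintro ⟨G, K⟩ h
    simp only [coe_filter, mem_univ, true_and, Set.mem_ofPred_eq] at h
    simp [disjointFrom, h.2.1]

theorem le_maxEntry {k : ℕ} (s : Fin k → ℕ) (v : Fin k) : s v ≤ maxEntry s :=
  le_sup (f := s) (mem_univ v)

theorem one_le_maxEntry {k : ℕ} {s : Fin k → ℕ} (hs : 0 < total s) : 1 ≤ maxEntry s := by
  obtain ⟨v, -, hv⟩ := exists_ne_zero_of_sum_ne_zero (f := s) (s := univ) (by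
    rw [total] at hs; omega)
  exact (Nat.one_le_iff_ne_zero.2 hv).trans (le_maxEntry s v)

theorem HasDegrees.abs_edge_sum_sub_le {H : BipGraph n m} {x : Fin n → ℕ} {y : Fin m → ℕ}
    (hH : HasDegrees H x y) {s : Fin n → ℕ} {t : Fin m → ℕ} (hM : 0 < total s)
    (hX : 0 < total x) (hxy : total x = total y) :
    |(∑ e ∈ H, (s e.1 : ℝ) * t e.2) / total s -
      ((∑ v, (s v : ℝ) * x v) * ∑ u, (t u : ℝ) * y u) / (total s * total x)| ≤
      2 * min (xiS s t x) (xiT s t y) := by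
  have hM0 : (0 : ℝ) < total s := by exact_mod_cast hM
  rw [mul_min_of_nonneg _ _ (by norm_num : (0 : ℝ) ≤ 2), le_min_iff]
  constructor
  · exact BipPairs.abs_edge_sum_sub_le hH.1 hH.2 s t hM0 hX
  -- Exchanging the two vertex classes centres `t` instead of `s`.
  · have := BipPairs.abs_edge_sum_sub_le (π := fun e : Fin n × Fin m => e.2) (ρ := fun e => e.1)
      hH.2 hH.1 t s hM0 (hxy ▸ hX)
    rw [← hxy] at this
    simp only [mul_comm (t _ : ℝ) (s _ : ℝ)] at this
    rw [mul_comm (∑ v, (s v : ℝ) * x v)]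
    exact this

theorem FHat_eq (s : Fin n → ℕ) (t : Fin m → ℕ) (x : Fin n → ℕ) (y : Fin m → ℕ) :
    FHat s t x y =
      ((total x).factorial : ℝ) / ((∏ v, ((x v).factorial : ℝ)) * ∏ u, ((y u).factorial : ℝ)) *
        (((total s).factorial : ℝ) /
          ((∏ v, ((s v).factorial : ℝ)) * ∏ u, ((t u).factorial : ℝ))) *
      Real.exp (-((fallTwo x : ℝ) * fallTwo y / (2 * (total x : ℝ) ^ 2)) -
        (fallTwo s : ℝ) * fallTwo t / (2 * (total s : ℝ) ^ 2) -
        ((∑ v, (s v : ℝ) * x v) * ∑ u, (t u : ℝ) * y u) / (total s * total x)) := by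
  rw [FHat, prod_mul_distrib, prod_mul_distrib, div_mul_div_comm]
  congr 1
  · congr 1 <;> ring
  · congr 1
    ring

/-- The one-graph estimate is used with `Δ = B`, `d = 0` for the second graph and with `Δ = A`, `d =
B` for the first, where `A` and `B` are the sums of the maximum degrees. The bounds for the first
are uniform in `H`, so summation is multiplication. -/
theorem BP_bounds {s : Fin n → ℕ} {t : Fin m → ℕ} {x : Fin n → ℕ} {y : Fin m → ℕ}
    (h : Admissible s t x y) (hxi : xi s t x y < 1 / 144) {ρ : ℝ}
    (hρ : ρ = 146 * (xi s t x y + min (xiS s t x) (xiT s t y))) :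
    FHat s t x y * Real.exp (-ρ) ≤ BP s t x y ∧
      (BP s t x y : ℝ) ≤ FHat s t x y * Real.exp ρ := by
  have hMpos : 0 < total s := by have := h.ten_lt_st; omega
  have hXpos : 0 < total x := by have := h.ten_lt_xy; omega
  have hM0 : (0 : ℝ) < total s := by exact_mod_cast hMpos
  have hX0 : (0 : ℝ) < total x := by exact_mod_cast hXpos
  set A := maxEntry s + maxEntry t with hA
  set B := maxEntry x + maxEntry y with hB
  have hA1 : 1 ≤ A := by have := one_le_maxEntry hMpos; omega
  have hB1 : 1 ≤ B := by have := one_le_maxEntry hXpos; omega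
  set ξ := xi s t x y with hξ
  have hξeq : ξ = (A : ℝ) ^ 4 / total s + (A : ℝ) ^ 2 * (B : ℝ) ^ 2 / total s +
      (B : ℝ) ^ 4 / total x := by
    rw [hξ, xi, hA, hB]; push_cast; ring
  have hA1' : (1 : ℝ) ≤ A := by exact_mod_cast hA1
  have hB1' : (1 : ℝ) ≤ B := by exact_mod_cast hB1
  have p1 : 0 ≤ (A : ℝ) ^ 4 / total s := by positivity
  have p2 : 0 ≤ (A : ℝ) ^ 2 * (B : ℝ) ^ 2 / total s := by positivity
  have p3 : 0 ≤ (B : ℝ) ^ 4 / total x := by positivity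
  -- Since `A, B ≥ 1`, the bound `ξ < 1/144` makes `72(BA + A²)` at most `M_st / 2`.
  have hcond1 : 36 * (B * A + A ^ 2) * 2 ≤ total s := by
    have q : ((A : ℝ) ^ 4 + (A : ℝ) ^ 2 * (B : ℝ) ^ 2) / total s ≤ 1 / 144 := by
      rw [add_div]; linarith
    rw [div_le_iff₀ hM0] at q
    have q1 : (A : ℝ) ^ 2 ≤ (A : ℝ) ^ 4 := pow_le_pow_right₀ hA1' (by norm_num)
    have q2 : (B : ℝ) * A ≤ (A : ℝ) ^ 2 * (B : ℝ) ^ 2 := by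
      have : 1 ≤ (B : ℝ) * A := by nlinarith
      nlinarith
    have : (36 * ((B : ℝ) * A + (A : ℝ) ^ 2) * 2 : ℝ) ≤ total s := by linarith
    exact_mod_cast this
  have hcond2 : 36 * (0 * B + B ^ 2) * 2 ≤ total x := by
    have q : (B : ℝ) ^ 4 / total x ≤ 1 / 144 := by linarith
    rw [div_le_iff₀ hX0] at q
    have q1 : (B : ℝ) ^ 2 ≤ (B : ℝ) ^ 4 := pow_le_pow_right₀ hB1' (by norm_num)
    have : (36 * (0 * (B : ℝ) + (B : ℝ) ^ 2) * 2 : ℝ) ≤ total x := by linarith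
    exact_mod_cast this
  have hsA : ∀ v, s v ≤ A := fun v => (le_maxEntry s v).trans (by omega)
  have htA : ∀ u, t u ≤ A := fun u => (le_maxEntry t u).trans (by omega)
  have hxB : ∀ v, x v ≤ B := fun v => (le_maxEntry x v).trans (by omega)
  have hyB : ∀ u, y u ≤ B := fun u => (le_maxEntry y u).trans (by omega)
  obtain ⟨k1, k2⟩ := card_disjointFrom_bounds (H := ∅) h.sum_xy hxB hyB
    (by simp [degLeft]) (by simp [degRight]) hB1 hcond2 rfl rfl rfl
  have each := fun H (hH : HasDegrees H x y) =>
    card_disjointFrom_bounds (H := H) h.sum_st hsA htA (fun v => (hH.1 v).trans_le (hxB v))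
      (fun u => (hH.2 u).trans_le (hyB u)) hA1 hcond1 rfl rfl rfl
  rw [FHat_eq]
  set c₁ : ℝ := ((total s).factorial : ℝ) /
    ((∏ v, ((s v).factorial : ℝ)) * ∏ u, ((t u).factorial : ℝ))
  set c₂ : ℝ := ((total x).factorial : ℝ) /
    ((∏ v, ((x v).factorial : ℝ)) * ∏ u, ((y u).factorial : ℝ))
  have hc₁ : 0 ≤ c₁ := by positivity
  have hc₂ : 0 ≤ c₂ := by positivity
  set l₁ : ℝ := (fallTwo s : ℝ) * fallTwo t / (2 * (total s : ℝ) ^ 2)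
  set l₂ : ℝ := (fallTwo x : ℝ) * fallTwo y / (2 * (total x : ℝ) ^ 2)
  set μ : ℝ := ((∑ v, (s v : ℝ) * x v) * ∑ u, (t u : ℝ) * y u) / (total s * total x)
  set w := min (xiS s t x) (xiT s t y)
  have hw0 : 0 ≤ w := by
    refine le_min ?_ ?_
    · have := irregularity_nonneg s
      unfold xiS; positivity
    · have := irregularity_nonneg t
      unfold xiT; positivity
  have hη₂ : 73 * (((0 : ℕ) : ℝ) * B + (B : ℝ) ^ 2) ^ 2 / total x = 73 * ((B : ℝ) ^ 4 / total x) := by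
    push_cast; ring
  -- The constant `146 = 2 · 73` comes from `(u + v)² ≤ 2u² + 2v²`.
  have hη₁ : 73 * ((B : ℝ) * A + (A : ℝ) ^ 2) ^ 2 / total s ≤
      146 * ((A : ℝ) ^ 4 / total s + (A : ℝ) ^ 2 * (B : ℝ) ^ 2 / total s) := by
    rw [← add_div, ← mul_div_assoc]
    refine div_le_div_of_nonneg_right ?_ hM0.le
    nlinarith [sq_nonneg ((B : ℝ) * A - (A : ℝ) ^ 2)]
  rw [hη₂] at k1 k2
  simp only [sum_empty, zero_div, zero_add] at k1 k2
  set η₁ := 73 * ((B : ℝ) * A + (A : ℝ) ^ 2) ^ 2 / total s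
  have lower : ∀ H ∈ disjointFrom x y ∅, c₁ * Real.exp (-μ - l₁ - 2 * w - η₁) ≤
      (#(disjointFrom s t H) : ℝ) := by
    intro H hH
    have hH' : HasDegrees H x y := by
      simp only [disjointFrom, mem_filter] at hH; exact hH.2.1
    refine le_trans ?_ (each H hH').1
    have := abs_le.1 (hH'.abs_edge_sum_sub_le (s := s) (t := t) hMpos hXpos h.sum_xy)
    gcongr
    linarith [this.1, this.2]
  have upper : ∀ H ∈ disjointFrom x y ∅, (#(disjointFrom s t H) : ℝ) ≤
      c₁ * Real.exp (-μ - l₁ + 2 * w + η₁) := by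
    intro H hH
    have hH' : HasDegrees H x y := by
      simp only [disjointFrom, mem_filter] at hH; exact hH.2.1
    refine (each H hH').2.trans ?_
    have := abs_le.1 (hH'.abs_edge_sum_sub_le (s := s) (t := t) hMpos hXpos h.sum_xy)
    gcongr
    linarith [this.1, this.2]
  rw [BP_eq_sum]
  push_cast
  constructor
  · calc c₂ * c₁ * Real.exp (-l₂ - l₁ - μ) * Real.exp (-ρ)
        ≤ c₂ * c₁ * Real.exp (-l₂ - l₁ - μ) *
          Real.exp (-(73 * ((B : ℝ) ^ 4 / total x)) - 2 * w - η₁) := by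
          gcongr
          linarith
      _ = c₂ * Real.exp (-l₂ - 73 * ((B : ℝ) ^ 4 / total x)) *
          (c₁ * Real.exp (-μ - l₁ - 2 * w - η₁)) := by
          rw [mul_assoc (c₂ * c₁), mul_mul_mul_comm c₂ _ c₁, ← Real.exp_add, ← Real.exp_add]
          congr 2; ring
      _ ≤ #(disjointFrom x y ∅) * (c₁ * Real.exp (-μ - l₁ - 2 * w - η₁)) := by gcongr
      _ ≤ ∑ H ∈ disjointFrom x y ∅, (#(disjointFrom s t H) : ℝ) := by
          rw [← nsmul_eq_mul]
          exact card_nsmul_le_sum _ _ _ lower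
  · calc ∑ H ∈ disjointFrom x y ∅, (#(disjointFrom s t H) : ℝ)
        ≤ #(disjointFrom x y ∅) * (c₁ * Real.exp (-μ - l₁ + 2 * w + η₁)) := by
          rw [← nsmul_eq_mul]
          exact sum_le_card_nsmul _ _ _ upper
      _ ≤ c₂ * Real.exp (-l₂ + 73 * ((B : ℝ) ^ 4 / total x)) *
          (c₁ * Real.exp (-μ - l₁ + 2 * w + η₁)) := by gcongr
      _ = c₂ * c₁ * Real.exp (-l₂ - l₁ - μ) *
          Real.exp (73 * ((B : ℝ) ^ 4 / total x) + 2 * w + η₁) := by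
          rw [mul_assoc (c₂ * c₁), mul_mul_mul_comm c₂ _ c₁, ← Real.exp_add, ← Real.exp_add]
          congr 2; ring
      _ ≤ c₂ * c₁ * Real.exp (-l₂ - l₁ - μ) * Real.exp ρ := by
          gcongr
          linarith

theorem FHat_pos (s : Fin n → ℕ) (t : Fin m → ℕ) (x : Fin n → ℕ) (y : Fin m → ℕ) :
    0 < FHat s t x y := by
  rw [FHat_eq]
  positivity

end Enumeration
end BipPairs

theorem theorem3p1 :
    ∃ ε C : ℝ, 0 < ε ∧ 0 < C ∧
      ∀ (n m : ℕ) (s : Fin n → ℕ) (t : Fin m → ℕ) (x : Fin n → ℕ) (y : Fin m → ℕ),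
        BipPairs.Admissible s t x y →
        BipPairs.xi s t x y < ε →
        ∃ θ : ℝ,
          |θ| ≤ C * (BipPairs.xi s t x y + min (BipPairs.xiS s t x) (BipPairs.xiT s t y)) ∧
          (BipPairs.BP s t x y : ℝ) = BipPairs.FHat s t x y * Real.exp θ := by
  refine ⟨1 / 144, 146, by norm_num, by norm_num, ?_⟩
  intro n m s t x y h hxi
  obtain ⟨h1, h2⟩ := BipPairs.BP_bounds h hxi rfl
  have hF := BipPairs.FHat_pos s t x y
  -- The lower bound forces at least one pair to exist, so the logarithm defining `θ` is meaningful.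
  have hpos : 0 < (BipPairs.BP s t x y : ℝ) / BipPairs.FHat s t x y :=
    div_pos ((mul_pos hF (Real.exp_pos _)).trans_le h1) hF
  refine ⟨Real.log (BipPairs.BP s t x y / BipPairs.FHat s t x y), abs_le.2 ⟨?_, ?_⟩, ?_⟩
  · rw [Real.le_log_iff_exp_le hpos, le_div_iff₀ hF, mul_comm]
    exact h1
  · rw [Real.log_le_iff_le_exp hpos, div_le_iff₀ hF, mul_comm]
    exact h2
  · rw [Real.exp_log hpos, mul_div_cancel₀ _ hF.ne']
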